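/- **Notation.** Let $N\ge 1$ be an integer, $C$ the Cartan matrix of $A_{N-1}$, $\mathcal I=2I-C$, and $e_1,\dots,e_{N-1}$ the unit vectors of $\mathbb Z^{N-1}$. Let $K$ be a Hausdorff topological field (for example $\mathbb C$, or a field of formal Laurent series) and let $t\in K$, $t\neq 0$, satisfy $t^n\to 0$; put $q=t^{4N}$ and $q^{e}:=t^{4Ne}$ for $e\in\frac1{4N}\mathbb Z$ (so $t$ is a fixed root $q^{1/(4N)}$). Write $(q)_n=\prod_{k=1}^n(1-q^k)$ for $n\ge 0$ and $1/(q)_n=0$ for $n<0$, and $\left[{m+n\atop m}\right]=\frac{(q)_{m+n}}{(q)_m(q)_n}$ if $m,n\ge 0$ are integers and $0$ otherwise. For $\eta\in\mathbb Z^{N-1}$, $(q)_\eta=\prod_i(q)_{\eta_i}$, $\left[{\mu+\eta\atop\eta}\right]=\prod_i\left[{\mu_i+\eta_i\atop\eta_i}\right]$. For $N=1$ the sums over $\eta$ consist of one term and $(C^{-1}\eta)_i=0$. For $L\in\mathbb Z_{\ge0}$ let $$T_0^{(N)}(L,a)=\sum_{\substack{\eta\in\mathbb Z^{N-1}\\ \frac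 L2+\frac aN+(C^{-1}\eta)_1\in\mathbb Z}}\frac{q^{\eta C^{-1}\eta}\,(q)_L}{(q)_{\frac L2-\frac aN-(C^{-1}\eta)_1}(q)_{\frac L2+\frac aN-(C^{-1}\eta)_{N-1}}(q)_\eta}.$$ For integers $A,B$, $\sigma\in\{0,1\}$ and rational $u,v$ let $$S_\sigma(A,B;u,v)=\sum_{\substack{\eta\in\mathbb Z^{N-1}\\ \frac{A-B+\sigma N}{2N}+(C^{-1}\eta)_1\in\mathbb Z}}q^{\eta C^{-1}\eta}\left[{\mu+\eta\atop\eta}\right]\left[{u-\frac12(B-\mu_1)\atop A}\right]\left[{v-\frac12(A-\mu_{N-1})\atop B}\right],$$ where $\mu+\eta=\frac12(\mathcal I\mu+Ae_1+Be_{N-1})$, and for $N=1$ one reads $\mu_1=B$, $\mu_0=A$. With $M_{12}=M_1-M_2$ let $$\begin{aligned}X^{(p,p'),N}_{r,s,\sigma}&(M_1,L_1,M_2,L_2)\\ =&\sum_{j\in\mathbb Z}q^{\frac jN(pp'j+p'(M_{12}+r)-ps)}\,S_\sigma\Bigl(M_1+pj,\,M_2-pj;\;M_1+L_1-\tfrac{(p'-p)j}N,\;M_2+L_2+\tfrac{(p'-p)j}N\Bigr)\\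 &-\sum_{j\in\mathbb Z}q^{\frac1N(pj+M_{12}+r)(p'j+s)}\,S_\sigma\Bigl(M_1+pj+r,\,M_2-pj-r;\;M_1+L_1-\tfrac{(p'-p)j-r+s}N,\;M_2+L_2+\tfrac{(p'-p)j-r+s}N\Bigr).\end{aligned}$$ **Statement.** Let $p,p',r,s,M_{12}\in\mathbb Z$, $L\in\mathbb Z_{\ge0}$, $\sigma\in\{0,1\}$ with $p\ge1$, $(p'-p)/N\in\mathbb Z_{\ge0}$, $(r-s)/N\in\mathbb Z$, $M_{12}+\sigma N$ even and $L-(r-s)/N+\sigma$ even. Put $$L_1=\tfrac12\Bigl(L-M_{12}-\tfrac{r-s}N\Bigr),\qquad L_2=\tfrac12\Bigl(L+M_{12}+\tfrac{r-s}N\Bigr).$$ (a) Then $$\begin{aligned}\lim_{\substack{M_1,M_2\to\infty\\ M_1-M_2=M_{12}}}(q)_L\,X^{(p,p'),N}_{r,s,\sigma}(M_1,L_1,M_2,L_2)=B:=\sum_{j\in\mathbb Z}\Bigl\{&q^{\frac jN(pp'j+p'(M_{12}+r)-ps)}\,T_0^{(N)}\bigl(L,\tfrac12(r+M_{12}-s)+p'j\bigr)\\&-q^{\frac1N(pj+M_{12}+r)(p'j+s)}\,T_0^{(N)}\bigl(L,\tfrac12(r+M_{12}+s)+p'j\bigr)\Bigr\}.\end{aligned}$$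 (b) Let moreover $p'=p+N$, $\rho:=r+M_{12}\in\{1,\dots,p-1\}$ and $s\in\{1,\dots,p'-1\}$. Then $B$ is proportional to a one-dimensional configuration sum of the level-$N$ fusion RSOS models of Date et al.: $$q^{\frac{(s-\rho)(s-\rho-N)}{4N}}\,B=\sum_{(\ell_1,\dots,\ell_{L+2})}q^{\frac14\sum_{k=1}^Lk\,|\ell_{k+2}-\ell_k|},$$ where the sum is over all sequences of heights $\ell_k\in\{1,\dots,p'-1\}$ with $\ell_1=s$, $\ell_{L+1}=\rho$, $\ell_{L+2}=\rho+N$ such that for all $1\le k\le L+1$: $\ell_k-\ell_{k+1}\in\{-N,-N+2,\dots,N\}$ and $\ell_k+\ell_{k+1}\in\{N+2,N+4,\dots,2p'-N-2\}$. -/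

import Mathlib

open Filter Topology

namespace QMult

noncomputable section

variable {K : Type*} [Field K]

/-- The variable `q`, given through a chosen `4N`-th root `t = q^{1/(4N)}`. -/
def base (N : ℕ) (t : K) : K := t ^ (4 * N)

/-- The fractional power `q^e := t^{4Ne}`, where `t = q^{1/(4N)}`. It is only used for exponents `e`
in `(1/(4N))ℤ`, for which `4Ne` is an integer and the floor does nothing. -/
def qpow (N : ℕ) (t : K) (e : ℚ) : K := t ^ (⌊4 * (N : ℚ) * e⌋ : ℤ)

/-- `(q)_n = ∏_{k=1}^n (1 - q^k)`. -/
def poch (q : K) (n : ℕ) : K := ∏ k ∈ Finset.range n, (1 - q ^ (k + 1))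

open Classical in
/-- `1/(q)_x`, with the convention that it is `0` unless `x` is a nonnegative integer. -/
def invPoch (q : K) (x : ℚ) : K :=
  if (⌊x⌋₊ : ℚ) = x then (poch q ⌊x⌋₊)⁻¹ else 0

open Classical in
/-- The `q`-binomial coefficient `[A; B]`: it is `(q)_A / ((q)_B (q)_{A-B})` if `B` and `A - B` are
nonnegative integers and `0` otherwise. -/
def qbinom (q : K) (A B : ℚ) : K :=
  if (⌊B⌋₊ : ℚ) = B ∧ (⌊A - B⌋₊ : ℚ) = A - B then
    poch q ⌊A⌋₊ / (poch q ⌊B⌋₊ * poch q ⌊A - B⌋₊)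
  else 0

/-- The Cartan matrix `C` of `A_{N-1}`, with rational entries; rows and columns `1, …, N-1` are
indexed by `0, …, N-2`. -/
def cartan (N : ℕ) : Matrix (Fin (N - 1)) (Fin (N - 1)) ℚ :=
  (CartanMatrix.A (N - 1)).map (fun z : ℤ => (z : ℚ))

/-- An integer vector viewed as a rational vector. -/
def toRat {N : ℕ} (η : Fin (N - 1) → ℤ) : Fin (N - 1) → ℚ := fun i => (η i : ℚ)

/-- `(C⁻¹ x)_i` for `1 ≤ i ≤ N-1` (one-based index), and `0` for other `i`. -/
def cinv (N : ℕ) (x : Fin (N - 1) → ℚ) (i : ℕ) : ℚ :=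
  if h : 1 ≤ i ∧ i ≤ N - 1 then ((cartan N)⁻¹.mulVec x) ⟨i - 1, by omega⟩ else 0

/-- `x C⁻¹ x`. -/
def quad (N : ℕ) (x : Fin (N - 1) → ℚ) : ℚ := x ⬝ᵥ ((cartan N)⁻¹.mulVec x)

/-- The vector `A e_1 + B e_{N-1} - 2 η`. -/
def source (N : ℕ) (A B : ℤ) (η : Fin (N - 1) → ℤ) : Fin (N - 1) → ℚ := fun i =>
  (if (i : ℕ) = 0 then (A : ℚ) else 0) + (if (i : ℕ) + 1 = N - 1 then (B : ℚ) else 0) - 2 * (η i : ℚ)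

/-- The solution `μ` of the system `μ + η = ½ (𝓘 μ + A e_1 + B e_{N-1})`, `𝓘 = 2 - C`, that is, of
`C μ = A e_1 + B e_{N-1} - 2 η`, extended by the boundary values `μ_0 = A` and `μ_N = B`
(one-based index). For `N = 1` these boundary values are all there is. -/
def mu (N : ℕ) (A B : ℤ) (η : Fin (N - 1) → ℤ) (i : ℕ) : ℚ :=
  if i = 0 then (A : ℚ) else if i = N then (B : ℚ) else cinv N (source N A B η) i

open Classical in
/-- The `q`-multinomial coefficient `T_n^{(N)}(L, a)`. -/
def multinomial (N : ℕ) (t : K) (n L : ℕ) (a : ℚ) : K :=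
  ∑ᶠ η : Fin (N - 1) → ℤ,
    if ∃ z : ℤ, (L : ℚ) / 2 + a / N + cinv N (toRat η) 1 = z then
      qpow N t (quad N (toRat η) - cinv N (toRat η) n) * poch (base N t) L
        * invPoch (base N t) ((L : ℚ) / 2 - a / N - cinv N (toRat η) 1)
        * invPoch (base N t) ((L : ℚ) / 2 + a / N - cinv N (toRat η) (N - 1))
        * ∏ i, invPoch (base N t) (η i : ℚ)
    else 0

open Classical in
/-- The sum over `η` that occurs in `X`:
`∑_η q^{η C⁻¹ η} [μ+η; η] [u - ½(B - μ_1); A] [v - ½(A - μ_{N-1}); B]`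
over all `η` with `(A - B + σN)/(2N) + (C⁻¹η)_1 ∈ ℤ`, where `μ + η = ½(𝓘 μ + A e_1 + B e_{N-1})`. -/
def etaSum (N : ℕ) (t : K) (σ A B : ℤ) (u v : ℚ) : K :=
  ∑ᶠ η : Fin (N - 1) → ℤ,
    if ∃ z : ℤ, ((A : ℚ) - B + σ * N) / (2 * N) + cinv N (toRat η) 1 = z then
      qpow N t (quad N (toRat η))
        * (∏ i : Fin (N - 1), qbinom (base N t) (mu N A B η (i + 1) + η i) (η i))
        * qbinom (base N t) (u - (B - mu N A B η 1) / 2) A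
        * qbinom (base N t) (v - (A - mu N A B η (N - 1)) / 2) B
    else 0

/-- The polynomials `X_{r,s,σ}^{(p,p'),N}(M₁, L₁, M₂, L₂)` (`P` stands for `p'`). -/
def X (N : ℕ) (t : K) (p P r s σ : ℤ) (M₁ : ℤ) (L₁ : ℚ) (M₂ : ℤ) (L₂ : ℚ) : K :=
  (∑ᶠ j : ℤ,
    qpow N t ((j : ℚ) / N * (p * P * j + P * ((M₁ - M₂) + r) - p * s))
      * etaSum N t σ (M₁ + p * j) (M₂ - p * j)
          (M₁ + L₁ - (P - p) * j / N) (M₂ + L₂ + (P - p) * j / N))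
  - ∑ᶠ j : ℤ,
    qpow N t (1 / (N : ℚ) * (p * j + (M₁ - M₂) + r) * (P * j + s))
      * etaSum N t σ (M₁ + p * j + r) (M₂ - p * j - r)
          (M₁ + L₁ - ((P - p) * j - r + s) / N) (M₂ + L₂ + ((P - p) * j - r + s) / N)

/-- The alternating sum over `j` of `q`-powers times `q`-multinomials `T_0^{(N)}(L, ·)`, where `D`
is the fixed value of `M₁ - M₂` and `P` stands for `p'`. -/
def bosonicSum (N : ℕ) (t : K) (p P r s D : ℤ) (L : ℕ) : K :=
  ∑ᶠ j : ℤ,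
    (qpow N t ((j : ℚ) / N * (p * P * j + P * (D + r) - p * s))
        * multinomial N t 0 L (1 / 2 * ((r : ℚ) + D - s) + P * j)
      - qpow N t (1 / (N : ℚ) * (p * j + D + r) * (P * j + s))
        * multinomial N t 0 L (1 / 2 * ((r : ℚ) + D + s) + P * j))

/-- Admissibility of neighbouring heights in the level-`N` fusion RSOS model of Date, Jimbo, Kuniba,
Miwa and Okado with heights `1, …, P-1`:
`x - y ∈ {-N, -N+2, …, N}` and `x + y ∈ {N+2, N+4, …, 2P-N-2}`. -/
def Admissible (N : ℕ) (P x y : ℤ) : Prop :=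
  |x - y| ≤ N ∧ Even (x - y + N) ∧ (N : ℤ) + 2 ≤ x + y ∧ x + y ≤ 2 * P - N - 2

open Classical in
/-- The one-dimensional configuration sum of Date et al.: the sum of
`q^{∑_{k=1}^L k |ℓ_{k+2} - ℓ_k| / 4}` over all height sequences `ℓ_1, …, ℓ_{L+2}` with values in
`{1, …, P-1}`, all neighbouring pairs admissible, `ℓ_1 = a`, `ℓ_{L+1} = b`, `ℓ_{L+2} = c`
(here the sequence is indexed from `0`). -/
def configSum (N : ℕ) (t : K) (P : ℤ) (L : ℕ) (a b c : ℤ) : K :=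
  ∑ h ∈ (Fintype.piFinset fun _ : Fin (L + 2) => Finset.Icc (1 : ℤ) (P - 1)).filter
      (fun h => (∀ k : Fin (L + 1), Admissible N P (h k.castSucc) (h k.succ)) ∧
        h 0 = a ∧ h (Fin.last L).castSucc = b ∧ h (Fin.last (L + 1)) = c),
    qpow N t (∑ k : Fin L,
      ((k : ℚ) + 1) * (|h k.succ.succ - h k.castSucc.castSucc| : ℤ) / 4)

end

end QMult

/-! ### Gaussian binomials and the operator calculus of the transform. -/

noncomputable section

namespace QTransform

/-! Applying f(L) ↦ ∑_j z^j q^{j²} [L; j] f(j) to the constant 1, N times over, gives a polynomial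
in z whose coefficient at z^m is, up to a power of t, the q-multinomial T_0 with m = NL/2 + a
(`multinomial_eq_vcoef`). Indeed, completing η to a tuple (n_0, …, n_N) with ∑ n_i = L and ∑ i n_i =
m turns ηC⁻¹η into ∑ min(i,j) n_i n_j − m²/N.

For (b), T_0 is embedded in a family indexed by 0 ≤ n ≤ N, with z replaced by z/q in the n outermost
factors. Commuting the transform past the shift, multiplication by q^L and a lowering operator
yields a closed recursion in L (`vfun_recursion`). Rescaled by a power of τ = t^N, it is the
transfer recursion for height sequences without walls (`pathGF_succ`). The walls are treated by
reflection. Alternating sums obey the same recursion, so the contributions of the forbidden heights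
must cancel. All forbidden heights beyond one wall lie on the same side of the height two steps on,
so the absolute values in the weights open up and the total becomes an alternating sum over
coefficients of `pfun`. The symmetry `pcoef_flip` then matches its positive and negative halves.
This gives `configSum_eq_altSum`, whose case n = 0 is (b).

For (a), inserting the solution μ turns the last two binomials of S_σ into [A+α; A] and [B+β; B],
where α, β are exactly the indices of the two Pochhammer symbols in T_0. Hence the η and j that can
contribute lie in finite sets independent of M_1, M_2, and the limit is termwise, by [n+c; n] →
1/(q)_c (`tendsto_etaSum`, `tendsto_finsum_etaSum`). -/

/-- The Gaussian binomial coefficient `[n; k]` in an arbitrary commutative ring, defined by the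
`q`-Pascal rule. -/
def gauss {R : Type*} [CommRing R] (q : R) : ℕ → ℕ → R
  | _, 0 => 1
  | 0, _ + 1 => 0
  | n + 1, k + 1 => q ^ (k + 1) * gauss q n (k + 1) + gauss q n k

section Gauss

variable {R : Type*} [CommRing R] (q : R)

@[simp] theorem gauss_zero_right (n : ℕ) : gauss q n 0 = 1 := by cases n <;> rfl

@[simp] theorem gauss_zero_succ (k : ℕ) : gauss q 0 (k + 1) = 0 := rfl

theorem gauss_succ_succ (n k : ℕ) :
    gauss q (n + 1) (k + 1) = q ^ (k + 1) * gauss q n (k + 1) + gauss q n k := rfl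

theorem gauss_eq_zero {n k : ℕ} (h : n < k) : gauss q n k = 0 := by
  induction n generalizing k with
  | zero => obtain ⟨k, rfl⟩ := Nat.exists_eq_succ_of_ne_zero (by omega : k ≠ 0); rfl
  | succ n ih =>
    obtain ⟨k, rfl⟩ := Nat.exists_eq_succ_of_ne_zero (by omega : k ≠ 0)
    rw [Nat.succ_eq_add_one, gauss_succ_succ, ih (by omega), ih (by omega)]; ring

/-- A denominator-free ratio of neighbouring binomials. Writing q^k − q^n rather than 1 − q^{n−k}
avoids truncated subtraction and needs no assumption on n and k. The second Pascal rule and the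
absorption rules follow from it. -/
theorem gauss_succ_right (n k : ℕ) :
    q ^ k * (1 - q ^ (k + 1)) * gauss q n (k + 1) = (q ^ k - q ^ n) * gauss q n k := by
  induction n generalizing k with
  | zero => cases k <;> simp
  | succ n ih =>
    cases k with
    | zero =>
      have h := ih 0
      simp only [gauss_succ_succ, gauss_zero_right] at h ⊢
      linear_combination q * h
    | succ k =>
      have h₁ := ih (k + 1)
      have h₀ := ih k
      simp only [gauss_succ_succ]
      linear_combination q ^ (k + 2) * h₁ + q * h₀

theorem gauss_succ_left (n k : ℕ) :
    q ^ k * gauss q (n + 1) (k + 1) = q ^ k * gauss q n (k + 1) + q ^ n * gauss q n k := by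
  rw [gauss_succ_succ]
  linear_combination -gauss_succ_right q n k

theorem one_sub_mul_gauss_succ_succ (n k : ℕ) :
    (1 - q ^ (k + 1)) * gauss q (n + 1) (k + 1) = (1 - q ^ (n + 1)) * gauss q n k := by
  rw [gauss_succ_succ]
  linear_combination q * gauss_succ_right q n k

theorem sub_mul_gauss_succ (n k : ℕ) :
    (q ^ k - q ^ (n + 1)) * gauss q (n + 1) k = (1 - q ^ (n + 1)) * q ^ k * gauss q n k := by
  cases k with
  | zero => simp
  | succ k =>
    rw [gauss_succ_succ]
    linear_combination -q * gauss_succ_right q n k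

theorem gauss_map {S : Type*} [CommRing S] (φ : R →+* S) (n k : ℕ) :
    φ (gauss q n k) = gauss (φ q) n k := by
  induction n generalizing k with
  | zero => cases k <;> simp
  | succ n ih => cases k <;> simp [gauss_succ_succ, ih]

end Gauss

section Operators

variable {R : Type*} [CommRing R] (q : R)

/-- The transform `f ↦ ∑_j y^j q^{j²} [L; j] f(j)`. -/
def qTrans (y : R) : Module.End R (ℕ → R) where
  toFun f L := ∑ j ∈ Finset.range (L + 1), y ^ j * q ^ (j ^ 2) * gauss q L j * f j
  map_add' f g := by
    funext L; simp only [Pi.add_apply, mul_add, Finset.sum_add_distrib]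
  map_smul' c f := by
    funext L
    simp only [Pi.smul_apply, smul_eq_mul, RingHom.id_apply, Finset.mul_sum]
    exact Finset.sum_congr rfl fun _ _ => by ring

/-- The shift `f(L) ↦ f(L + 1)`. -/
def qShift : Module.End R (ℕ → R) where
  toFun f L := f (L + 1)
  map_add' _ _ := rfl
  map_smul' _ _ := rfl

/-- Multiplication by `q^L`. -/
def mulQ : Module.End R (ℕ → R) where
  toFun f L := q ^ L * f L
  map_add' _ _ := by funext L; simp [mul_add]
  map_smul' _ _ := by funext L; simp [mul_left_comm]

/-- The lowering operator `f(L) ↦ (1 - q^L) f(L - 1)`. -/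
def qLower : Module.End R (ℕ → R) where
  toFun f L := (1 - q ^ L) * f (L - 1)
  map_add' _ _ := by funext L; simp [mul_add]
  map_smul' _ _ := by funext L; simp [mul_left_comm]

theorem trans_apply (y : R) (f : ℕ → R) (L : ℕ) :
    qTrans q y f L = ∑ j ∈ Finset.range (L + 1), y ^ j * q ^ (j ^ 2) * gauss q L j * f j := rfl

theorem trans_apply_succ (y : R) (f : ℕ → R) (L : ℕ) :
    qTrans q y f L = ∑ j ∈ Finset.range (L + 2), y ^ j * q ^ (j ^ 2) * gauss q L j * f j := by
  rw [Finset.sum_range_succ, gauss_eq_zero q (Nat.lt_succ_self L), trans_apply]; simp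

@[simp] theorem shift_apply (f : ℕ → R) (L : ℕ) : qShift f L = f (L + 1) := rfl
@[simp] theorem mulQ_apply (f : ℕ → R) (L : ℕ) : mulQ q f L = q ^ L * f L := rfl
@[simp] theorem lower_apply (f : ℕ → R) (L : ℕ) : qLower q f L = (1 - q ^ L) * f (L - 1) := rfl
@[simp] theorem shift_one : qShift (1 : ℕ → R) = 1 := rfl

/-- The defining Pascal rule applied inside the sum; the part with [L; j] is reindexed by y^{j+1}
q^{(j+1)²} = qy · (q²y)^j q^{j²}. The other Pascal rule gives `shift_trans'`; having both forms is
what makes later differences telescope. -/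
theorem shift_trans (y : R) (f : ℕ → R) :
    qShift (qTrans q y f) = qTrans q (q * y) f + (q * y) • qTrans q (q * (q * y)) (qShift f) := by
  funext L
  simp only [shift_apply, Pi.add_apply, Pi.smul_apply, smul_eq_mul]
  rw [trans_apply_succ q (q * y) f L, trans_apply, trans_apply, Finset.sum_range_succ',
    Finset.sum_range_succ' _ (L + 1), Finset.mul_sum, add_right_comm, ← Finset.sum_add_distrib]
  congr 1
  · refine Finset.sum_congr rfl fun j _ => ?_
    rw [gauss_succ_succ, shift_apply]; ring
  · simp

theorem shift_trans' (y : R) (f : ℕ → R) :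
    qShift (qTrans q y f) = qTrans q y f + (q * y) • mulQ q (qTrans q (q * y) (qShift f)) := by
  funext L
  simp only [shift_apply, Pi.add_apply, Pi.smul_apply, smul_eq_mul, mulQ_apply]
  rw [trans_apply_succ q y f L, trans_apply, trans_apply, Finset.sum_range_succ',
    Finset.sum_range_succ' _ (L + 1), Finset.mul_sum, Finset.mul_sum, add_right_comm,
    ← Finset.sum_add_distrib]
  congr 1
  · refine Finset.sum_congr rfl fun j _ => ?_
    rw [shift_apply]
    linear_combination y ^ (j + 1) * q ^ (j ^ 2 + j + 1) * f (j + 1) * gauss_succ_left q L j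
  · simp

theorem trans_mulQ (y : R) (f : ℕ → R) : qTrans q y (mulQ q f) = qTrans q (q * y) f := by
  funext L
  simp only [trans_apply, mulQ_apply]
  exact Finset.sum_congr rfl fun _ _ => by ring

/-- Absorption: (1 − q^j)[L; j] = (1 − q^L)[L−1; j−1]. The truncated L − 1 at L = 0 is harmless
because of the factor 1 − q^L. -/
theorem trans_lower (y : R) (f : ℕ → R) :
    qTrans q y (qLower q f) = qLower q ((q * y) • qTrans q (q * (q * y)) f) := by
  funext L
  cases L with
  | zero => simp [trans_apply]
  | succ L =>
    simp only [lower_apply, Pi.smul_apply, smul_eq_mul, Nat.add_sub_cancel]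
    rw [trans_apply, trans_apply, Finset.sum_range_succ', Finset.mul_sum, Finset.mul_sum]
    simp only [lower_apply, pow_zero, sub_self, zero_mul, mul_zero, add_zero,
      Nat.add_sub_cancel]
    refine Finset.sum_congr rfl fun j _ => ?_
    linear_combination y ^ (j + 1) * q ^ ((j + 1) ^ 2) * f j * one_sub_mul_gauss_succ_succ q L j

theorem trans_mulQ_eq (y : R) (f : ℕ → R) :
    qTrans q y (mulQ q f) = mulQ q (qTrans q y f) + qLower q (qTrans q (q * y) f) := by
  funext L
  cases L with
  | zero => simp [trans_apply]
  | succ L =>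
    simp only [lower_apply, Pi.add_apply, mulQ_apply, Nat.add_sub_cancel]
    rw [trans_apply_succ q (q * y) f L, trans_apply, trans_apply, Finset.mul_sum, Finset.mul_sum,
      ← Finset.sum_add_distrib]
    refine Finset.sum_congr rfl fun j _ => ?_
    rw [mulQ_apply]
    linear_combination y ^ j * q ^ (j ^ 2) * f j * sub_mul_gauss_succ q L j

variable (w : R)

/-- `A_w^n A_{qw}^{N-n} 1`, where `A_y` is the transform with parameter `y`. -/
def vfun (N n : ℕ) : ℕ → R := (qTrans q w ^ n) ((qTrans q (q * w) ^ (N - n)) 1)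

/-- `A_{qw}^{N-k} A_{q²w}^k 1`. -/
def cfun (N k : ℕ) : ℕ → R := (qTrans q (q * w) ^ (N - k)) ((qTrans q (q * (q * w)) ^ k) 1)

/-- `A_{qw}^{N-n} E A_w^n 1`, where `E` is the shift. -/
def pfun (N n : ℕ) : ℕ → R := (qTrans q (q * w) ^ (N - n)) (qShift ((qTrans q w ^ n) 1))

theorem pow_succ_apply' {M : Type*} [AddCommGroup M] [Module R M] (f : Module.End R M) (n : ℕ)
    (x : M) : (f ^ (n + 1)) x = f ((f ^ n) x) := by rw [pow_succ']; rfl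

theorem pow_succ_apply {M : Type*} [AddCommGroup M] [Module R M] (f : Module.End R M) (n : ℕ)
    (x : M) : (f ^ (n + 1)) x = (f ^ n) (f x) := by rw [pow_succ]; rfl

/-- Expanding the first term by `shift_trans` and the second by `shift_trans'` produces the same
leading term, and what remains is qw times the transform at q²w of the previous difference. So each
step contributes one factor qw and one transform. -/
theorem shift_trans_sub (n : ℕ) :
    qShift (qTrans q w ((qTrans q w ^ n) 1)) - qTrans q (q * w) (qShift ((qTrans q w ^ n) 1)) =
      (q * w) ^ (n + 1) • (qTrans q (q * (q * w)) ^ (n + 1)) 1 := by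
  induction n with
  | zero =>
    rw [shift_trans]
    simp
  | succ n ih =>
    have h : qTrans q (q * w) (qShift (qTrans q w ((qTrans q w ^ n) 1))) =
        qTrans q (q * w) (qTrans q w ((qTrans q w ^ n) 1)) + (q * w) • qTrans q (q * (q * w))
          (qTrans q (q * w) (qShift ((qTrans q w ^ n) 1))) := by
      rw [shift_trans' q w ((qTrans q w ^ n) 1), map_add, map_smul, trans_mulQ]
    have ih' := congrArg (qTrans q (q * (q * w))) ih
    rw [map_sub, map_smul, ← pow_succ_apply' _ (n + 1)] at ih'
    rw [pow_succ_apply' (qTrans q w) n, shift_trans q w (qTrans q w _), h,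
      pow_succ' (q * w) (n + 1), mul_smul (q * w) ((q * w) ^ (n + 1)), ← ih', smul_sub]
    abel

theorem pfun_succ {N n : ℕ} (h : n < N) :
    pfun q w N (n + 1) = pfun q w N n + (q * w) ^ (n + 1) • cfun q w N (n + 1) := by
  rw [pfun, pfun, cfun, ← map_smul, ← shift_trans_sub, map_sub, ← pow_succ_apply', ← pow_succ_apply,
    show N - (n + 1) + 1 = N - n by omega]
  abel

theorem pfun_zero (N : ℕ) : pfun q w N 0 = cfun q w N 0 := by simp [pfun, cfun]

theorem pfun_eq_sum {N n : ℕ} (h : n ≤ N) :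
    pfun q w N n = ∑ k ∈ Finset.range (n + 1), (q * w) ^ k • cfun q w N k := by
  induction n with
  | zero => simp [pfun_zero]
  | succ n ih => rw [pfun_succ q w (by omega), ih (by omega), Finset.sum_range_succ _ (n + 1)]

theorem pfun_self (N : ℕ) : pfun q w N N = qShift (vfun q w N N) := by simp [pfun, vfun]

theorem vfun_succ_succ (N n : ℕ) : vfun q w (N + 1) (n + 1) = qTrans q w (vfun q w N n) := by
  rw [vfun, vfun, pow_succ_apply', Nat.add_sub_add_right]

theorem pfun_succ_left {N n : ℕ} (h : n ≤ N) :
    pfun q w (N + 1) n = qTrans q (q * w) (pfun q w N n) := by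
  rw [pfun, pfun, ← pow_succ_apply', Nat.sub_add_comm h]

/-- The two relations must be proved together: each one at N + 1 comes from applying a transform to
both of them at N and commuting it past `mulQ` and `qLower`. The extreme indices n = N and n = 0
come directly from `shift_trans'` and `trans_mulQ_eq`. -/
theorem pfun_vfun_relations (N : ℕ) :
    (∀ n < N, pfun q w N (n + 1) = vfun q w N (n + 1) + (q * w) • mulQ q (pfun q w N n)) ∧
      ∀ n < N, vfun q w N n = mulQ q (vfun q w N (n + 1)) + qLower q (pfun q w N n) := by
  induction N with
  | zero => simp
  | succ N ih =>
    obtain ⟨ih₁, ih₂⟩ := ih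
    have key : ∀ n < N, pfun q w (N + 1) (n + 1) = qTrans q (q * w) (vfun q w N (n + 1)) +
        (q * w) • qTrans q (q * (q * w)) (pfun q w N n) := by
      intro n hn
      rw [pfun_succ_left q w (by omega), ih₁ n hn, map_add, map_smul, trans_mulQ]
    constructor
    · intro n hn
      rcases Nat.lt_succ_iff_lt_or_eq.mp hn with hn | rfl
      · have h₁ := congrArg (qTrans q w) (ih₂ n hn)
        rw [map_add, trans_mulQ, trans_lower, ← vfun_succ_succ, map_smul] at h₁
        have h₂ := trans_mulQ_eq q (q * w) (pfun q w N n)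
        rw [trans_mulQ] at h₂
        rw [key n hn, h₁, pfun_succ_left q w hn.le]
        nth_rewrite 1 [h₂]
        rw [smul_add]
        abel
      · rw [pfun_self, vfun_succ_succ, shift_trans', ← pfun_self, pfun_succ_left q w le_rfl]
    · intro n hn
      cases n with
      | zero =>
        have h := trans_mulQ_eq q w ((qTrans q (q * w) ^ N) 1)
        rw [trans_mulQ] at h
        simpa [vfun, pfun, pow_succ_apply'] using h
      | succ n =>
        have hn' : n < N := by omega
        rw [vfun_succ_succ, vfun_succ_succ, key n hn', ih₂ n hn', map_add, trans_mulQ_eq,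
          trans_lower, map_add, add_assoc]

theorem pfun_eq_sum_vfun {N n : ℕ} (h : n ≤ N) :
    pfun q w N n = ∑ k ∈ Finset.range (n + 1),
      (q * w) ^ (n - k) • ((mulQ q) ^ (n - k)) (vfun q w N k) := by
  induction n with
  | zero => simp [pfun, vfun]
  | succ n ih =>
    rw [(pfun_vfun_relations q w N).1 n h, ih (by omega), Finset.sum_range_succ _ (n + 1),
      map_sum, Finset.smul_sum, add_comm]
    congr 1
    · refine Finset.sum_congr rfl fun k hk => ?_
      rw [show n + 1 - k = n - k + 1 by have := Finset.mem_range.mp hk; omega, map_smul,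
        pow_succ_apply', smul_smul, pow_succ']
    · simp

/-- The recursion in `L` satisfied by the family `vfun`. -/
theorem vfun_recursion {N n : ℕ} (h : n ≤ N) (L : ℕ) :
    vfun q w N n (L + 1) = ∑ k ∈ Finset.range (N + 1),
      (q * w) ^ k * (q ^ (L + 1)) ^ (k - n) * cfun q w N k L := by
  induction h using Nat.decreasingInduction with
  | self =>
    have h := congrFun (pfun_self q w N) L
    rw [shift_apply] at h
    rw [← h, pfun_eq_sum q w le_rfl, Finset.sum_apply]
    refine Finset.sum_congr rfl fun k hk => ?_
    rw [show k - N = 0 by have := Finset.mem_range.mp hk; omega]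
    simp
  -- The second relation at L + 1 reads V_n = q^{L+1} V_{n+1} + (1 − q^{L+1}) P_n. For k ≤ n the two
  -- weights add up to 1; for k > n only the first survives and raises the exponent by one.
  -- Truncated subtraction encodes max(k − n, 0).
  | of_succ n hn ih =>
    rw [congrFun ((pfun_vfun_relations q w N).2 n hn) (L + 1), Pi.add_apply, mulQ_apply,
      lower_apply, ih, Nat.add_sub_cancel, pfun_eq_sum q w hn.le, Finset.sum_apply]
    have h₁ : ∑ k ∈ Finset.range (n + 1), ((q * w) ^ k • cfun q w N k) L =
        ∑ k ∈ Finset.range (N + 1), if k ≤ n then (q * w) ^ k * cfun q w N k L else 0 := by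
      rw [← Finset.sum_filter]
      refine Finset.sum_congr ?_ fun _ _ => rfl
      ext k; simp only [Finset.mem_range, Finset.mem_filter]; omega
    rw [h₁, Finset.mul_sum, Finset.mul_sum, ← Finset.sum_add_distrib]
    refine Finset.sum_congr rfl fun k _ => ?_
    split_ifs with hk
    · rw [show k - n = 0 by omega, show k - (n + 1) = 0 by omega]; ring
    · rw [show k - n = k - (n + 1) + 1 by omega]; ring

end Operators

end QTransform

end

/-! ### Coefficients in z and their reflection symmetry. -/

noncomputable section

namespace QTransform

section Coefficients

open Polynomial

variable {K : Type*} [Field K]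

/-- The coefficient of a polynomial at an integer exponent, `0` at negative exponents. -/
def coefz (f : K[X]) (m : ℤ) : K := if 0 ≤ m then f.coeff m.toNat else 0

theorem coefz_of_neg (f : K[X]) {m : ℤ} (h : m < 0) : coefz f m = 0 := if_neg (by omega)

theorem coefz_C_mul (a : K) (f : K[X]) (m : ℤ) : coefz (C a * f) m = a * coefz f m := by
  unfold coefz; split_ifs <;> simp

theorem coefz_X_pow_mul (k : ℕ) (f : K[X]) (m : ℤ) :
    coefz (X ^ k * f) m = coefz f (m - k) := by
  unfold coefz
  split_ifs with h₁ h₂ h₂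
  · rw [coeff_X_pow_mul', if_pos (by omega)]; congr 1; omega
  · rw [coeff_X_pow_mul', if_neg (by omega)]
  · omega
  · rfl

theorem coefz_sum {ι : Type*} (s : Finset ι) (f : ι → K[X]) (m : ℤ) :
    coefz (∑ i ∈ s, f i) m = ∑ i ∈ s, coefz (f i) m := by
  unfold coefz; split_ifs <;> simp

theorem coefz_one (m : ℤ) : coefz (1 : K[X]) m = if m = 0 then 1 else 0 := by
  unfold coefz
  rw [coeff_one]
  split_ifs <;> first | rfl | omega

theorem coefz_comp_C_mul_X (q : K) (f : K[X]) (m : ℤ) :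
    coefz (f.comp (C q * X)) m = q ^ m * coefz f m := by
  unfold coefz
  split_ifs with h
  · obtain ⟨n, rfl⟩ := Int.eq_ofNat_of_zero_le h
    rw [comp_C_mul_X_coeff, mul_comm]; simp
  · simp

/-- The coefficient of `z^m` in `vfun`. -/
def vcoef (q : K) (N n L : ℕ) (m : ℤ) : K := coefz (vfun (C q) (C q⁻¹ * X) N n L) m

/-- The coefficient of `z^m` in `cfun`. -/
def ccoef (q : K) (N k L : ℕ) (m : ℤ) : K := coefz (cfun (C q) (C q⁻¹ * X) N k L) m

/-- The coefficient of `z^m` in `pfun`. -/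
def pcoef (q : K) (N k L : ℕ) (m : ℤ) : K := coefz (pfun (C q) (C q⁻¹ * X) N k L) m

theorem C_mul_C_inv_mul_X {q : K} (hq : q ≠ 0) : C q * (C q⁻¹ * X) = (X : K[X]) := by
  rw [← mul_assoc, ← C_mul, mul_inv_cancel₀ hq, C_1, one_mul]

theorem trans_map {R S : Type*} [CommRing R] [CommRing S] (φ : R →+* S) (q y : R) (f : ℕ → R)
    (L : ℕ) : φ (qTrans q y f L) = qTrans (φ q) (φ y) (fun j => φ (f j)) L := by
  simp [trans_apply, gauss_map]

theorem trans_pow_map {R S : Type*} [CommRing R] [CommRing S] (φ : R →+* S) (q y : R) (f : ℕ → R)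
    (n L : ℕ) :
    φ ((qTrans q y ^ n) f L) = (qTrans (φ q) (φ y) ^ n) (fun j => φ (f j)) L := by
  induction n generalizing L with
  | zero => rfl
  | succ n ih => rw [pow_succ_apply', pow_succ_apply', trans_map]; simp only [ih]

/-- With w = z/q the transforms in `cfun` have parameters z and qz, those in `vfun` z/q and z, so
the substitution z ↦ z/q carries one family to the other. This closes the recursion on a single
family. -/
theorem vcoef_eq {q : K} (hq : q ≠ 0) {N n : ℕ} (h : n ≤ N) (L : ℕ) (m : ℤ) :
    vcoef q N n L m = q ^ (-m) * ccoef q N (N - n) L m := by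
  have key : (cfun (C q) (C q⁻¹ * X) N (N - n) L).comp (C q⁻¹ * X) =
      vfun (C q) (C q⁻¹ * X) N n L := by
    rw [← coe_compRingHom_apply, cfun, vfun, trans_pow_map, C_mul_C_inv_mul_X hq]
    simp only [trans_pow_map]
    have h₁ : compRingHom (C q⁻¹ * X) (C q * X) = (X : K[X]) := by
      simp [C_mul_C_inv_mul_X hq]
    have h₂ : (fun j : ℕ => compRingHom (C q⁻¹ * X) ((1 : ℕ → K[X]) j)) = 1 := by
      funext; simp
    have h₃ : compRingHom (C q⁻¹ * X) (C q) = (C q : K[X]) := by simp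
    have h₄ : compRingHom (C q⁻¹ * X) X = (C q⁻¹ * X : K[X]) := by simp
    rw [h₁, h₂, h₃, h₄, Nat.sub_sub_self h]
  rw [vcoef, ccoef, ← key, coefz_comp_C_mul_X q⁻¹, inv_zpow']

theorem ccoef_eq {q : K} (hq : q ≠ 0) {N k : ℕ} (h : k ≤ N) (L : ℕ) (m : ℤ) :
    ccoef q N k L m = q ^ m * vcoef q N (N - k) L m := by
  rw [vcoef_eq hq (Nat.sub_le N k), Nat.sub_sub_self h, ← mul_assoc, ← zpow_add₀ hq]
  simp

theorem vcoef_recursion {q : K} (hq : q ≠ 0) {N n : ℕ} (h : n ≤ N) (L : ℕ) (m : ℤ) :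
    vcoef q N n (L + 1) m = ∑ k ∈ Finset.range (N + 1),
      (q ^ (L + 1)) ^ (k - n) * ccoef q N k L (m - k) := by
  rw [vcoef, vfun_recursion _ _ h, coefz_sum]
  refine Finset.sum_congr rfl fun k _ => ?_
  rw [C_mul_C_inv_mul_X hq, mul_assoc, coefz_X_pow_mul, ← C_pow, ← C_pow, coefz_C_mul, ccoef]

theorem pcoef_eq_sum {q : K} (hq : q ≠ 0) {N n : ℕ} (h : n ≤ N) (L : ℕ) (m : ℤ) :
    pcoef q N n L m = ∑ k ∈ Finset.range (n + 1), ccoef q N k L (m - k) := by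
  rw [pcoef, pfun_eq_sum _ _ h, Finset.sum_apply, coefz_sum]
  refine Finset.sum_congr rfl fun k _ => ?_
  rw [C_mul_C_inv_mul_X hq, Pi.smul_apply, smul_eq_mul, coefz_X_pow_mul, ccoef]

theorem mulQ_pow_apply {R : Type*} [CommRing R] (q : R) (n : ℕ) (f : ℕ → R) (L : ℕ) :
    (mulQ q ^ n) f L = (q ^ L) ^ n * f L := by
  induction n with
  | zero => simp
  | succ n ih => rw [pow_succ_apply', mulQ_apply, ih]; ring

theorem pcoef_eq_sum_vcoef {q : K} (hq : q ≠ 0) {N n : ℕ} (h : n ≤ N) (L : ℕ) (m : ℤ) :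
    pcoef q N n L m = ∑ k ∈ Finset.range (n + 1),
      (q ^ L) ^ (n - k) * vcoef q N k L (m - (n - k : ℕ)) := by
  rw [pcoef, pfun_eq_sum_vfun _ _ h, Finset.sum_apply, coefz_sum]
  refine Finset.sum_congr rfl fun k _ => ?_
  rw [C_mul_C_inv_mul_X hq, Pi.smul_apply, smul_eq_mul, coefz_X_pow_mul, mulQ_pow_apply,
    ← C_pow, ← C_pow, coefz_C_mul, vcoef]

theorem trans_pow_zero {R : Type*} [CommRing R] (q y : R) (n : ℕ) (f : ℕ → R) :
    (qTrans q y ^ n) f 0 = f 0 := by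
  induction n with
  | zero => rfl
  | succ n ih => rw [pow_succ_apply', trans_apply]; simp [ih]

theorem vcoef_zero (q : K) (N n : ℕ) (m : ℤ) : vcoef q N n 0 m = if m = 0 then 1 else 0 := by
  rw [vcoef, vfun, trans_pow_zero, trans_pow_zero, Pi.one_apply, coefz_one]

theorem vcoef_of_neg (q : K) (N n L : ℕ) {m : ℤ} (h : m < 0) : vcoef q N n L m = 0 :=
  coefz_of_neg _ h

theorem vcoef_of_lt {q : K} (hq : q ≠ 0) {N n : ℕ} (hn : n ≤ N) (L : ℕ) {m : ℤ}
    (h : (N : ℤ) * L < m) : vcoef q N n L m = 0 := by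
  induction L generalizing n m with
  | zero => rw [vcoef_zero, if_neg (by simp at h; omega)]
  | succ L ih =>
    rw [vcoef_recursion hq hn]
    refine Finset.sum_eq_zero fun k hk => ?_
    have hk' : k ≤ N := by have := Finset.mem_range.mp hk; omega
    rw [ccoef_eq hq hk', ih (Nat.sub_le _ _), mul_zero, mul_zero]
    push_cast at h
    have : (k : ℤ) ≤ N := by exact_mod_cast hk'
    linarith

/-- Induction on L: reversing k ↦ N − k in the recursion exchanges max(k − n, 0) with max(n − k, 0),
and these differ by the linear term k − n, which goes into the power of q. -/
theorem vcoef_flip {q : K} (hq : q ≠ 0) {N n : ℕ} (hn : n ≤ N) (L : ℕ) (m : ℤ) :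
    vcoef q N n L (N * L - m) = q ^ ((N : ℤ) * L ^ 2 - 2 * L * m - n * L) * ccoef q N n L m := by
  induction L generalizing n m with
  | zero =>
    rw [ccoef_eq hq hn]
    simp only [vcoef_zero, Nat.cast_zero, mul_zero, zero_sub, neg_eq_zero]
    split_ifs with h
    · simp [h]
    · simp
  | succ L ih =>
    rw [ccoef_eq hq hn, vcoef_recursion hq hn, vcoef_recursion hq (Nat.sub_le _ _),
      ← Finset.sum_range_reflect, Finset.mul_sum, Finset.mul_sum]
    refine Finset.sum_congr rfl fun k hk => ?_
    have hk' : k ≤ N := by have := Finset.mem_range.mp hk; omega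
    rw [show N + 1 - 1 - k = N - k by omega, ccoef_eq hq (Nat.sub_le N k), Nat.sub_sub_self hk',
      show (N : ℤ) * ((L + 1 : ℕ) : ℤ) - m - ((N - k : ℕ) : ℤ) = N * L - (m - k) by
        push_cast [Nat.cast_sub hk']; ring, ih hk', ← zpow_natCast, ← zpow_natCast,
      ← zpow_natCast, ← zpow_mul, ← zpow_mul, ← mul_assoc, ← mul_assoc, ← mul_assoc,
      ← mul_assoc, ← zpow_add₀ hq, ← zpow_add₀ hq, ← zpow_add₀ hq, ← zpow_add₀ hq]
    congr 2
    rcases le_total (N - k) n with h | h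
    · rw [Nat.sub_eq_zero_of_le h]
      push_cast [Nat.cast_sub (show N - n ≤ k by omega), Nat.cast_sub hn]
      ring
    · rw [Nat.sub_eq_zero_of_le (show k ≤ N - n by omega)]
      push_cast [Nat.cast_sub h, Nat.cast_sub hk']
      ring

/-- The expansion of `pfun` in `vfun`, with powers of q^L, and its expansion in `cfun` are matched
term by term by `vcoef_flip`. -/
theorem pcoef_flip {q : K} (hq : q ≠ 0) {N n : ℕ} (hn : n ≤ N) (L : ℕ) (m : ℤ) :
    pcoef q N n L (N * L + n - m) = q ^ (((N : ℤ) * L + n) * L - 2 * L * m) * pcoef q N n L m := by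
  rw [pcoef_eq_sum_vcoef hq hn, pcoef_eq_sum hq hn, Finset.mul_sum]
  refine Finset.sum_congr rfl fun k hk => ?_
  have hk' : k ≤ n := by have := Finset.mem_range.mp hk; omega
  rw [show (N : ℤ) * L + n - m - ((n - k : ℕ) : ℤ) = N * L - (m - k) by
    push_cast [Nat.cast_sub hk']; ring, vcoef_flip hq (hk'.trans hn), ← zpow_natCast,
    ← zpow_natCast, ← zpow_mul, ← mul_assoc, ← zpow_add₀ hq]
  congr 2
  push_cast [Nat.cast_sub hk']
  ring

end Coefficients

end QTransform

end

/-! ### Alternating sums and cancellation at the walls. -/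

noncomputable section

namespace QTransform

section Alternating

variable {K : Type*} [Field K]

theorem pcoef_of_neg {q : K} (N n L : ℕ) {m : ℤ} (h : m < 0) : pcoef q N n L m = 0 :=
  coefz_of_neg _ h

theorem finite_support_of_bounded {M : Type*} [Zero M] (g : ℤ → M) (B : ℤ)
    (h₀ : ∀ m < 0, g m = 0) (h₁ : ∀ m, B < m → g m = 0) : g.support.Finite :=
  (Set.finite_Icc (0 : ℤ) B).subset fun m hm => by
    rw [Function.mem_support] at hm
    exact ⟨not_lt.mp fun h => hm (h₀ m h), not_lt.mp fun h => hm (h₁ m h)⟩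

theorem finite_support_vcoef {q : K} (hq : q ≠ 0) {N n : ℕ} (hn : n ≤ N) (L : ℕ) :
    (vcoef q N n L).support.Finite :=
  finite_support_of_bounded _ (N * L) (fun _ => vcoef_of_neg q N n L)
    fun _ => vcoef_of_lt hq hn L

theorem finite_support_pcoef {q : K} (hq : q ≠ 0) {N n : ℕ} (hn : n ≤ N) (L : ℕ) :
    (pcoef q N n L).support.Finite := by
  refine finite_support_of_bounded _ (N * L + N) (fun _ => pcoef_of_neg N n L) fun m hm => ?_
  rw [pcoef_eq_sum hq hn]
  refine Finset.sum_eq_zero fun k hk => ?_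
  have hk' : k ≤ N := by have := Finset.mem_range.mp hk; omega
  have : (k : ℤ) ≤ N := by exact_mod_cast hk'
  rw [ccoef_eq hq hk', vcoef_of_lt hq (Nat.sub_le _ _) L (by linarith), mul_zero]

theorem finite_support_arith (c : ℤ → K) {g : ℤ → K} (hg : g.support.Finite) (m : ℤ) {P : ℤ}
    (hP : P ≠ 0) : (fun j => c j * g (m + P * j)).support.Finite := by
  refine (hg.preimage (f := fun j => m + P * j) ?_).subset fun j hj => ?_
  · intro i _ j _ hij
    exact mul_left_cancel₀ hP (add_left_cancel hij)
  · exact right_ne_zero_of_mul hj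

/-- The alternating sum of a finitely supported function over two arithmetic progressions. -/
def altSum (τ : K) (P s m : ℤ) (g : ℤ → K) : K :=
  ∑ᶠ j : ℤ, (τ ^ (-4 * P * j ^ 2 + 4 * s * j - 2 * P * j) * g (m + P * j) -
    τ ^ (-2 * (P * j + s) * (2 * j + 1)) * g (m + s + P * j))

variable (τ : K) {P : ℤ} (s : ℤ)

theorem finite_support_altSum (hP : P ≠ 0) (m : ℤ) {g : ℤ → K} (hg : g.support.Finite) :
    (fun j : ℤ => τ ^ (-4 * P * j ^ 2 + 4 * s * j - 2 * P * j) * g (m + P * j) -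
      τ ^ (-2 * (P * j + s) * (2 * j + 1)) * g (m + s + P * j)).support.Finite :=
  ((finite_support_arith (fun j => τ ^ (-4 * P * j ^ 2 + 4 * s * j - 2 * P * j)) hg m hP).union
    (finite_support_arith (fun j => τ ^ (-2 * (P * j + s) * (2 * j + 1))) hg (m + s) hP)).subset
    (Function.support_sub _ _)

/-- The weights in `altSum` involve neither m nor L, so it is linear and compatible with
translations; recursions in L therefore pass through it unchanged. -/
theorem altSum_sum (hP : P ≠ 0) (m : ℤ) {ι : Type*} (S : Finset ι) (a : ι → K) (d : ι → ℤ)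
    (g : ι → ℤ → K) (hg : ∀ i ∈ S, (g i).support.Finite) :
    altSum τ P s m (fun x => ∑ i ∈ S, a i * g i (x - d i)) =
      ∑ i ∈ S, a i * altSum τ P s (m - d i) (g i) := by
  simp only [altSum]
  simp only [mul_finsum]
  rw [← finsum_sum_comm]
  · refine finsum_congr fun j => ?_
    rw [Finset.mul_sum, Finset.mul_sum, ← Finset.sum_sub_distrib]
    refine Finset.sum_congr rfl fun i _ => ?_
    rw [show m + P * j - d i = m - d i + P * j by ring,
      show m + s + P * j - d i = m - d i + s + P * j by ring]
    ring
  · intro i hi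
    refine (finite_support_altSum τ s hP (m - d i) (hg i hi)).subset fun j hj => ?_
    exact right_ne_zero_of_mul hj

theorem altSum_const_mul (hP : P ≠ 0) (m : ℤ) (a : K) {g : ℤ → K} (hg : g.support.Finite) :
    altSum τ P s m (fun x => a * g x) = a * altSum τ P s m g := by
  simpa using altSum_sum τ s hP m {()} (fun _ => a) (fun _ => 0) (fun _ => g) (by simpa using hg)

theorem altSum_eq_zero (hP : P ≠ 0) (m : ℤ) {g : ℤ → K} (hg : g.support.Finite) (i : ℤ)
    (h : ∀ j : ℤ, τ ^ (-4 * P * j ^ 2 + 4 * s * j - 2 * P * j) * g (m + P * j) =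
      τ ^ (-2 * (P * (i - j) + s) * (2 * (i - j) + 1)) * g (m + s + P * (i - j))) :
    altSum τ P s m g = 0 := by
  have h₁ := finite_support_arith (fun j => τ ^ (-4 * P * j ^ 2 + 4 * s * j - 2 * P * j)) hg m hP
  have h₂ := finite_support_arith (fun j => τ ^ (-2 * (P * j + s) * (2 * j + 1))) hg (m + s) hP
  rw [altSum, finsum_sub_distrib h₁ h₂, finsum_congr h, sub_eq_zero]
  exact finsum_comp_equiv (Equiv.subLeft i)
    (f := fun j => τ ^ (-2 * (P * j + s) * (2 * j + 1)) * g (m + s + P * j))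

variable {τ}

/-- The condition on s + 2m makes the flip send m + Pj to m + s + P(−1 − j), so the two progressions
cancel under j ↦ −1 − j. At the lower wall the pairing is j ↦ −j. -/
theorem altSum_pcoef_upper (hτ : τ ≠ 0) (hP : P ≠ 0) {N n : ℕ} (hn : n ≤ N) (L : ℕ) {m : ℤ}
    (hm : s + 2 * m = N * L + n + P) :
    altSum τ P s m (fun x => τ ^ (-x * (4 * L + 2)) * pcoef (τ ^ 4) N n L x) = 0 := by
  have hq : τ ^ 4 ≠ 0 := pow_ne_zero 4 hτ
  refine altSum_eq_zero τ s hP m ((finite_support_pcoef hq hn L).subset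
    fun x hx => right_ne_zero_of_mul hx) (-1) fun j => ?_
  have h := pcoef_flip hq hn L (m + P * j)
  rw [show (N : ℤ) * L + n - (m + P * j) = m + s + P * (-1 - j) by linear_combination -hm,
    ← zpow_natCast τ 4, ← zpow_mul] at h
  simp only [← zpow_natCast τ 4]
  rw [h, ← mul_assoc, ← mul_assoc, ← mul_assoc, ← zpow_add₀ hτ, ← zpow_add₀ hτ, ← zpow_add₀ hτ]
  congr 2
  push_cast
  linear_combination (4 * L : ℤ) * hm

theorem altSum_pcoef_lower (hτ : τ ≠ 0) (hP : P ≠ 0) {N n : ℕ} (hn : n ≤ N) (L : ℕ) {m b : ℤ}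
    (hb : (n : ℤ) = N - b) (hm : s + 2 * m = N * L + N + b) :
    altSum τ P s m (fun x => τ ^ (-x * (4 * L - 2)) * pcoef (τ ^ 4) N n L (x - b)) = 0 := by
  have hq : τ ^ 4 ≠ 0 := pow_ne_zero 4 hτ
  have hsupp : (fun x => pcoef (τ ^ 4) N n L (x - b)).support.Finite :=
    (finite_support_pcoef hq hn L).preimage (f := fun x => x - b)
      (sub_left_injective.injOn)
  refine altSum_eq_zero τ s hP m (hsupp.subset
    fun x hx => right_ne_zero_of_mul hx) 0 fun j => ?_
  have h := pcoef_flip hq hn L (m + P * j - b)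
  rw [show (N : ℤ) * L + n - (m + P * j - b) = m + s + P * (0 - j) - b by
      linear_combination -hm + hb,
    ← zpow_natCast τ 4, ← zpow_mul] at h
  simp only [← zpow_natCast τ 4]
  rw [h, ← mul_assoc, ← mul_assoc, ← mul_assoc, ← zpow_add₀ hτ, ← zpow_add₀ hτ, ← zpow_add₀ hτ]
  congr 2
  push_cast
  rw [hb]
  linear_combination (4 * L : ℤ) * hm

end Alternating

end QTransform

end

/-! ### The transfer recursion for configuration sums. -/

noncomputable section

namespace QMult

section ConfigSum

variable {K : Type*} [Field K]

theorem qpow_eq (N : ℕ) (t : K) {e : ℚ} {z : ℤ} (h : 4 * (N : ℚ) * e = z) :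
    qpow N t e = t ^ z := by
  rw [qpow, h, Int.floor_intCast]

/-- The set of height sequences that enter the configuration sum. -/
def paths (N : ℕ) (P : ℤ) (L : ℕ) (a b c : ℤ) : Finset (Fin (L + 2) → ℤ) :=
  open Classical in
  (Fintype.piFinset fun _ : Fin (L + 2) => Finset.Icc (1 : ℤ) (P - 1)).filter
      (fun h => (∀ k : Fin (L + 1), Admissible N P (h k.castSucc) (h k.succ)) ∧
        h 0 = a ∧ h (Fin.last L).castSucc = b ∧ h (Fin.last (L + 1)) = c)

theorem mem_paths {N : ℕ} {P : ℤ} {L : ℕ} {a b c : ℤ} {h : Fin (L + 2) → ℤ} :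
    h ∈ paths N P L a b c ↔ (∀ k, 1 ≤ h k ∧ h k ≤ P - 1) ∧
      (∀ k : Fin (L + 1), Admissible N P (h k.castSucc) (h k.succ)) ∧
        h 0 = a ∧ h (Fin.last L).castSucc = b ∧ h (Fin.last (L + 1)) = c := by
  simp only [paths, Finset.mem_filter, Fintype.mem_piFinset, Finset.mem_Icc]

theorem configSum_eq {t : K} (ht : t ≠ 0) (N : ℕ) (P : ℤ) (L : ℕ) (a b c : ℤ) :
    configSum N t P L a b c = ∑ h ∈ paths N P L a b c,
      ∏ k : Fin L, (t ^ N) ^ (((k : ℤ) + 1) * |h k.succ.succ - h k.castSucc.castSucc|) := by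
  rw [configSum, paths]
  refine Finset.sum_congr rfl fun h _ => ?_
  have key : ∀ (S : Finset (Fin L)) (e : Fin L → ℤ),
      ∏ k ∈ S, (t ^ N) ^ e k = t ^ (N * ∑ k ∈ S, e k) := by
    intro S e
    classical
    induction S using Finset.induction_on with
    | empty => simp
    | insert k S hk ih =>
      rw [Finset.prod_insert hk, Finset.sum_insert hk, ih, mul_add, zpow_add₀ ht, zpow_mul,
        zpow_mul, zpow_natCast]
  rw [key]
  apply qpow_eq
  push_cast
  rw [Finset.mul_sum, Finset.mul_sum]
  exact Finset.sum_congr rfl fun k _ => by ring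

theorem configSum_of_not_admissible {t : K} (ht : t ≠ 0) {N : ℕ} {P : ℤ} (L : ℕ) (a : ℤ) {b c : ℤ}
    (h : ¬ Admissible N P b c) : configSum N t P L a b c = 0 := by
  rw [configSum_eq ht]
  refine Finset.sum_eq_zero fun x hx => ?_
  obtain ⟨-, h₁, -, h₂, h₃⟩ := mem_paths.mp hx
  have := h₁ (Fin.last L)
  rw [Fin.succ_last, h₂, h₃] at this
  exact absurd this h

theorem configSum_zero {t : K} (ht : t ≠ 0) {N : ℕ} {P a b c : ℤ} (h : Admissible N P b c)
    (hb : 1 ≤ b ∧ b ≤ P - 1) (hc : 1 ≤ c ∧ c ≤ P - 1) :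
    configSum N t P 0 a b c = if b = a then 1 else 0 := by
  rw [configSum_eq ht]
  split_ifs with hab
  · have : paths N P 0 a b c = {![b, c]} := by
      ext x
      rw [mem_paths, Finset.mem_singleton]
      constructor
      · rintro ⟨-, -, -, h₁, h₂⟩
        ext i
        fin_cases i
        · exact h₁
        · exact h₂
      · rintro rfl
        refine ⟨?_, ?_, hab, rfl, rfl⟩
        · intro i
          fin_cases i
          · exact hb
          · exact hc
        · intro i
          fin_cases i
          exact h
    rw [this]; simp
  · have : paths N P 0 a b c = ∅ := by
      refine Finset.eq_empty_of_forall_notMem fun x hx => hab ?_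
      obtain ⟨-, -, h₁, h₂, -⟩ := mem_paths.mp hx
      rw [← h₁, ← h₂]; rfl
    rw [this]; simp

theorem init_mem_paths {N : ℕ} {P : ℤ} {L : ℕ} {a b c d : ℤ} {h : Fin (L + 3) → ℤ}
    (hh : h ∈ paths N P (L + 1) a b c) (hd : h (Fin.last L).castSucc.castSucc = d) :
    (Fin.init h : Fin (L + 2) → ℤ) ∈ paths N P L a d b := by
  obtain ⟨h₁, h₂, h₃, h₄, -⟩ := mem_paths.mp hh
  refine mem_paths.mpr ⟨fun k => h₁ k.castSucc, fun k => ?_, h₃, hd, h₄⟩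
  have := h₂ k.castSucc
  rwa [Fin.succ_castSucc] at this

theorem snoc_mem_paths {N : ℕ} {P : ℤ} {L : ℕ} {a b c d : ℤ} {h : Fin (L + 2) → ℤ}
    (hh : h ∈ paths N P L a d b) (hbc : Admissible N P b c) (hc : 1 ≤ c ∧ c ≤ P - 1) :
    (Fin.snoc h c : Fin (L + 3) → ℤ) ∈ paths N P (L + 1) a b c := by
  obtain ⟨h₁, h₂, h₃, h₄, h₅⟩ := mem_paths.mp hh
  refine mem_paths.mpr ⟨?_, ?_, ?_, ?_, ?_⟩
  · refine Fin.lastCases ?_ fun k => ?_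
    · simpa using hc
    · simpa using h₁ k
  · refine Fin.lastCases ?_ fun k => ?_
    · rw [Fin.succ_last, Fin.snoc_castSucc, Fin.snoc_last, h₅]; exact hbc
    · rw [Fin.succ_castSucc, Fin.snoc_castSucc, Fin.snoc_castSucc]; exact h₂ k
  · rw [← Fin.castSucc_zero, Fin.snoc_castSucc, h₃]
  · rw [Fin.snoc_castSucc, h₅]
  · rw [Fin.snoc_last]

/-- Deleting the last height removes exactly the top term of the weight. Since weights couple
next-nearest neighbours, the state must record the last two heights. -/
theorem configSum_succ {t : K} (ht : t ≠ 0) {N : ℕ} {P : ℤ} (L : ℕ) (a : ℤ) {b c : ℤ}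
    (hbc : Admissible N P b c) (hc : 1 ≤ c ∧ c ≤ P - 1) :
    configSum N t P (L + 1) a b c = ∑ d ∈ Finset.Icc 1 (P - 1),
      (t ^ N) ^ (((L : ℤ) + 1) * |c - d|) * configSum N t P L a d b := by
  rw [configSum_eq ht, ← Finset.sum_fiberwise_of_maps_to
    (g := fun h => h (Fin.last L).castSucc.castSucc) (t := Finset.Icc 1 (P - 1))
    fun h hh => Finset.mem_Icc.mpr ((mem_paths.mp hh).1 _)]
  refine Finset.sum_congr rfl fun d _ => ?_
  rw [configSum_eq ht, Finset.mul_sum]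
  refine Finset.sum_bij' (fun h _ => Fin.init h) (fun h _ => Fin.snoc h c) ?_ ?_ ?_ ?_ ?_
  · intro h hh
    rw [Finset.mem_filter] at hh
    exact init_mem_paths hh.1 hh.2
  · intro h hh
    rw [Finset.mem_filter]
    refine ⟨snoc_mem_paths hh hbc hc, ?_⟩
    rw [Fin.snoc_castSucc]
    exact (mem_paths.mp hh).2.2.2.1
  · intro h hh
    rw [Finset.mem_filter] at hh
    have := (mem_paths.mp hh.1).2.2.2.2
    rw [← this]
    exact Fin.snoc_init_self h
  · intro h _
    exact Fin.init_snoc _ _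
  · intro h hh
    rw [Finset.mem_filter] at hh
    have := (mem_paths.mp hh.1).2.2.2.2
    rw [Fin.prod_univ_castSucc, mul_comm, Fin.succ_last, Fin.succ_last, this, hh.2, Fin.val_last]
    rfl

end ConfigSum

end QMult

end

/-! ### Restricted configuration sums from unrestricted ones. -/

noncomputable section

namespace QTransform

section Paths

variable {K : Type*} [Field K] {τ : K}

/-- The weighted number of unrestricted height sequences, with `q = τ^4`. -/
def pathGF (τ : K) (N L n : ℕ) (m : ℤ) : K :=
  τ ^ ((N : ℤ) * L * (L - 1) - m * (4 * L - 2) + 2 * n * L) * vcoef (τ ^ 4) N n L m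

theorem finite_support_pathGF (hτ : τ ≠ 0) {N n : ℕ} (hn : n ≤ N) (L : ℕ) :
    (pathGF τ N L n).support.Finite :=
  (finite_support_vcoef (pow_ne_zero 4 hτ) hn L).subset fun _ hx => right_ne_zero_of_mul hx

theorem pathGF_zero (N n : ℕ) (m : ℤ) : pathGF τ N 0 n m = if m = 0 then 1 else 0 := by
  rw [pathGF, vcoef_zero]
  split_ifs with h
  · simp [h]
  · simp

theorem pathGF_sub (hτ : τ ≠ 0) {N k : ℕ} (hk : k ≤ N) (L : ℕ) (m : ℤ) :
    pathGF τ N L (N - k) (m - k) =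
      τ ^ ((N : ℤ) * L * (L + 1) - m * (4 * L + 2) + k * (2 * L + 2)) *
        ccoef (τ ^ 4) N k L (m - k) := by
  rw [pathGF, ccoef_eq (pow_ne_zero 4 hτ) hk, ← mul_assoc, ← zpow_natCast τ 4, ← zpow_mul,
    ← zpow_add₀ hτ]
  congr 2
  push_cast [Nat.cast_sub hk]
  ring

/-- The prefactor of `pathGF` symmetrises the weight: 4 max(x, 0) = 2|x| + 2x with x = k − n, and
the linear part is absorbed. -/
theorem pathGF_succ (hτ : τ ≠ 0) {N n : ℕ} (hn : n ≤ N) (L : ℕ) (m : ℤ) :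
    pathGF τ N (L + 1) n m = ∑ k ∈ Finset.range (N + 1),
      τ ^ (2 * ((L : ℤ) + 1) * |(k : ℤ) - n|) * pathGF τ N L (N - k) (m - k) := by
  rw [pathGF, vcoef_recursion (pow_ne_zero 4 hτ) hn, Finset.mul_sum]
  refine Finset.sum_congr rfl fun k hk => ?_
  have hk' : k ≤ N := by have := Finset.mem_range.mp hk; omega
  rw [pathGF_sub hτ hk', ← mul_assoc, ← mul_assoc, ← zpow_natCast, ← zpow_natCast,
    ← zpow_natCast, ← zpow_mul, ← zpow_mul, ← zpow_add₀ hτ, ← zpow_add₀ hτ]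
  congr 2
  rcases le_total k n with h | h
  · rw [abs_of_nonpos (by simpa using h), Nat.sub_eq_zero_of_le h]
    push_cast
    ring
  · rw [abs_of_nonneg (by simpa using h)]
    push_cast [Nat.cast_sub h]
    ring

theorem sum_pathGF_upper (hτ : τ ≠ 0) {N n : ℕ} (hn : n ≤ N) (L : ℕ) (m : ℤ) :
    ∑ k ∈ Finset.range (n + 1), τ ^ (-2 * ((L : ℤ) + 1) * k) * pathGF τ N L (N - k) (m - k) =
      τ ^ ((N : ℤ) * L * (L + 1)) * (τ ^ (-m * (4 * L + 2)) * pcoef (τ ^ 4) N n L m) := by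
  rw [pcoef_eq_sum (pow_ne_zero 4 hτ) hn, Finset.mul_sum, Finset.mul_sum]
  refine Finset.sum_congr rfl fun k hk => ?_
  have hk' : k ≤ n := by have := Finset.mem_range.mp hk; omega
  rw [pathGF_sub hτ (hk'.trans hn), ← mul_assoc, ← mul_assoc, ← zpow_add₀ hτ, ← zpow_add₀ hτ]
  congr 2
  ring

theorem sum_pathGF_lower (hτ : τ ≠ 0) {N b : ℕ} (hb : b ≤ N) (L : ℕ) (m : ℤ) :
    ∑ k ∈ Finset.Ico b (N + 1), τ ^ (2 * ((L : ℤ) + 1) * k) * pathGF τ N L (N - k) (m - k) =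
      τ ^ ((N : ℤ) * L * (L + 1) + 4 * L * b) *
        (τ ^ (-m * (4 * L - 2)) * pcoef (τ ^ 4) N (N - b) L (m - b)) := by
  rw [pcoef_eq_sum_vcoef (pow_ne_zero 4 hτ) (Nat.sub_le _ _), Finset.mul_sum, Finset.mul_sum,
    Finset.sum_Ico_eq_sum_range, ← Finset.sum_range_reflect _ (N - b + 1),
    Nat.sub_add_comm hb]
  refine Finset.sum_congr rfl fun i hi => ?_
  have hi' : i ≤ N - b := by have := Finset.mem_range.mp hi; omega
  rw [pathGF, show N - b + 1 - 1 - i = N - b - i by omega, show N - b - (N - b - i) = i by omega,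
    show N - (b + i) = N - b - i by omega,
    show m - (b : ℤ) - (i : ℕ) = m - ((b + i : ℕ) : ℤ) by push_cast; ring,
    ← mul_assoc, ← mul_assoc, ← mul_assoc, ← zpow_natCast, ← zpow_natCast,
    ← zpow_natCast, ← zpow_mul, ← zpow_mul, ← zpow_add₀ hτ, ← zpow_add₀ hτ, ← zpow_add₀ hτ]
  congr 2
  push_cast [Nat.cast_sub hi', Nat.cast_sub hb]
  ring

variable {P : ℤ} (s : ℤ)

theorem altSum_pathGF_succ (hτ : τ ≠ 0) (hP : P ≠ 0) {N n : ℕ} (hn : n ≤ N) (L : ℕ) (m : ℤ) :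
    altSum τ P s m (pathGF τ N (L + 1) n) = ∑ k ∈ Finset.range (N + 1),
      τ ^ (2 * ((L : ℤ) + 1) * |(k : ℤ) - n|) *
        altSum τ P s (m - k) (pathGF τ N L (N - k)) := by
  rw [← altSum_sum τ s hP m _ (fun k : ℕ => τ ^ (2 * ((L : ℤ) + 1) * |(k : ℤ) - n|))
    (fun k => (k : ℤ)) _ fun k _ => finite_support_pathGF hτ (Nat.sub_le N k) L]
  congr 1
  funext x
  exact pathGF_succ hτ hn L x

theorem sum_altSum_upper (hτ : τ ≠ 0) (hP : P ≠ 0) {N n : ℕ} (hn : n ≤ N) (L : ℕ) {m : ℤ}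
    (hm : s + 2 * m = N * L + n + P) :
    ∑ k ∈ Finset.range (n + 1), τ ^ (-2 * ((L : ℤ) + 1) * k) *
      altSum τ P s (m - k) (pathGF τ N L (N - k)) = 0 := by
  rw [← altSum_sum τ s hP m _ (fun k : ℕ => τ ^ (-2 * ((L : ℤ) + 1) * k))
    (fun k => (k : ℤ)) _ fun k _ => finite_support_pathGF hτ (Nat.sub_le N k) L]
  simp only [sum_pathGF_upper hτ hn]
  rw [altSum_const_mul τ s hP, altSum_pcoef_upper s hτ hP hn L hm, mul_zero]
  exact (finite_support_pcoef (pow_ne_zero 4 hτ) hn L).subset fun _ hx => right_ne_zero_of_mul hx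

theorem sum_altSum_lower (hτ : τ ≠ 0) (hP : P ≠ 0) {N b : ℕ} (hb : b ≤ N) (L : ℕ) {m : ℤ}
    (hm : s + 2 * m = N * L + N + b) :
    ∑ k ∈ Finset.Ico b (N + 1), τ ^ (2 * ((L : ℤ) + 1) * k) *
      altSum τ P s (m - k) (pathGF τ N L (N - k)) = 0 := by
  rw [← altSum_sum τ s hP m _ (fun k : ℕ => τ ^ (2 * ((L : ℤ) + 1) * k))
    (fun k => (k : ℤ)) _ fun k _ => finite_support_pathGF hτ (Nat.sub_le N k) L]
  simp only [sum_pathGF_lower hτ hb]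
  rw [altSum_const_mul τ s hP, altSum_pcoef_lower s hτ hP (Nat.sub_le N b) L
    (by push_cast [Nat.cast_sub hb]; ring) hm, mul_zero]
  exact ((finite_support_pcoef (pow_ne_zero 4 hτ) (Nat.sub_le N b) L).preimage
    (f := fun x => x - (b : ℤ)) sub_left_injective.injOn).subset
      fun _ hx => right_ne_zero_of_mul hx

/-- Both heights s and s + 2m lie strictly between 0 and P, hence |m| < P and 0 < m + s < P, and
only j = 0 in the positive progression can hit 0. -/
theorem altSum_pathGF_zero {s m : ℤ} (N n : ℕ) (hs : 1 ≤ s ∧ s ≤ P - 1)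
    (hb : 1 ≤ s + 2 * m ∧ s + 2 * m ≤ P - 1) :
    altSum τ P s m (pathGF τ N 0 n) = if m = 0 then 1 else 0 := by
  rw [altSum, finsum_eq_single _ 0]
  · have : m + s ≠ 0 := by omega
    simp [pathGF_zero, this]
  · intro j hj
    have h₁ : m + P * j ≠ 0 := by
      rcases lt_or_gt_of_ne hj with h | h
      · have : P * j ≤ P * (-1) := mul_le_mul_of_nonneg_left (by omega) (by omega)
        omega
      · have : P * 1 ≤ P * j := mul_le_mul_of_nonneg_left (by omega) (by omega)
        omega
    have h₂ : m + s + P * j ≠ 0 := by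
      rcases lt_or_gt_of_ne hj with h | h
      · have : P * j ≤ P * (-1) := mul_le_mul_of_nonneg_left (by omega) (by omega)
        omega
      · have : P * 1 ≤ P * j := mul_le_mul_of_nonneg_left (by omega) (by omega)
        omega
    simp [pathGF_zero, h₁, h₂]

open QMult in
/-- The restricted configuration sums as alternating sums of unrestricted ones. -/
theorem configSum_eq_altSum {t : K} (ht : t ≠ 0) {N : ℕ} {P s : ℤ} (hs : 1 ≤ s ∧ s ≤ P - 1)
    (L n : ℕ) (m b c : ℤ) (hn : n ≤ N) (hb : b = s - N * L + 2 * m) (hc : c = b + N - 2 * n)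
    (hadm : Admissible N P b c) (hb₁ : 1 ≤ b ∧ b ≤ P - 1) (hc₁ : 1 ≤ c ∧ c ≤ P - 1) :
    configSum N t P L s b c = altSum (t ^ N) P s m (pathGF (t ^ N) N L n) := by
  have hτ : t ^ N ≠ 0 := pow_ne_zero N ht
  have hP : P ≠ 0 := by omega
  induction L generalizing n m b c with
  | zero =>
    simp only [Nat.cast_zero, mul_zero, sub_zero] at hb
    rw [configSum_zero ht hadm hb₁ hc₁, altSum_pathGF_zero N n hs (hb ▸ hb₁)]
    congr 1
    exact propext ⟨fun h => by omega, fun h => by omega⟩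
  | succ L ih =>
    have hb' : b = s - N * L + 2 * m - N := by rw [hb]; push_cast; ring
    obtain ⟨-, -, hlo, hhi⟩ := id hadm
    rw [configSum_succ ht L s hadm hc₁, altSum_pathGF_succ s hτ hP hn]
    set g : ℕ → K := fun k => (t ^ N) ^ (2 * ((L : ℤ) + 1) * |(k : ℤ) - n|) *
      altSum (t ^ N) P s (m - k) (pathGF (t ^ N) N L (N - k)) with hg
    -- Here k stands for the height d = b + N − 2k, and k ≥ b means b + d < N + 2. Admissibility of
    -- (b, c) gives n < b, so |k − n| = k − n and the n-dependence factors out of the sum.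
    have hA : ∑ k ∈ (Finset.range (N + 1)).filter (fun k : ℕ => b ≤ k), g k = 0 := by
      obtain ⟨b', rfl⟩ := Int.eq_ofNat_of_zero_le (show 0 ≤ b by omega)
      by_cases hbN : b' ≤ N
      · have h := sum_altSum_lower s hτ hP hbN L (m := m) (by linarith)
        rw [← mul_zero ((t ^ N) ^ (-(2 * ((L : ℤ) + 1) * n))), ← h, Finset.mul_sum]
        refine Finset.sum_congr ?_ fun k hk => ?_
        · ext k; simp only [Finset.mem_filter, Finset.mem_range, Finset.mem_Ico]; omega
        · rw [Finset.mem_Ico] at hk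
          simp only [hg]
          rw [← mul_assoc, ← zpow_add₀ hτ, abs_of_nonneg (show (0 : ℤ) ≤ (k : ℤ) - n by omega)]
          congr 2
          ring
      · refine Finset.sum_eq_zero fun k hk => ?_
        simp only [Finset.mem_filter, Finset.mem_range] at hk
        omega
    -- The other wall: k ≤ b + N − P means b + d > 2P − N − 2, and admissibility of (b, c) now
    -- forces k < n.
    have hB : ∑ k ∈ (Finset.range (N + 1)).filter (fun k : ℕ => (k : ℤ) ≤ b + N - P), g k = 0 := by
      by_cases hbN : 0 ≤ b + N - P
      · obtain ⟨r, hr⟩ := Int.eq_ofNat_of_zero_le hbN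
        have h := sum_altSum_upper s hτ hP (show r ≤ N by omega) L (m := m) (by linarith)
        rw [← mul_zero ((t ^ N) ^ (2 * ((L : ℤ) + 1) * n)), ← h, Finset.mul_sum]
        refine Finset.sum_congr ?_ fun k hk => ?_
        · ext k; simp only [Finset.mem_filter, Finset.mem_range]; omega
        · rw [Finset.mem_range] at hk
          simp only [hg]
          rw [← mul_assoc, ← zpow_add₀ hτ, abs_of_nonpos (show (k : ℤ) - n ≤ 0 by omega)]
          congr 2
          ring
      · refine Finset.sum_eq_zero fun k hk => ?_
        simp only [Finset.mem_filter, Finset.mem_range] at hk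
        omega
    have hsplit : ∑ k ∈ Finset.range (N + 1), g k =
        ∑ k ∈ (Finset.range (N + 1)).filter (fun k : ℕ => (k : ℤ) < b ∧ b + N - P < k), g k := by
      rw [← Finset.sum_filter_add_sum_filter_not _ (fun k : ℕ => b ≤ k), hA, zero_add,
        ← Finset.sum_filter_add_sum_filter_not (Finset.filter _ _)
          (fun k : ℕ => (k : ℤ) ≤ b + N - P)]
      have h₁ : ((Finset.range (N + 1)).filter (fun k : ℕ => ¬ b ≤ k)).filter
          (fun k : ℕ => (k : ℤ) ≤ b + N - P) =
          (Finset.range (N + 1)).filter (fun k : ℕ => (k : ℤ) ≤ b + N - P) := by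
        ext k; simp only [Finset.mem_filter, Finset.mem_range]; omega
      rw [h₁, hB, zero_add]
      refine Finset.sum_congr ?_ fun _ _ => rfl
      ext k; simp only [Finset.mem_filter, Finset.mem_range]; omega
    classical
    rw [hsplit, ← Finset.sum_filter_of_ne (p := fun d => Admissible N P d b)
      fun d _ hd => by_contra fun h => hd (by rw [configSum_of_not_admissible ht L s h, mul_zero])]
    refine Finset.sum_nbij' (fun d => ((b + N - d) / 2).toNat) (fun k => b + N - 2 * k)
      ?_ ?_ ?_ ?_ ?_
    · intro d hd
      simp only [Finset.mem_filter, Finset.mem_Icc, Finset.mem_range, Admissible, abs_le] at hd ⊢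
      obtain ⟨_, _, ⟨e, he⟩, _⟩ := hd
      omega
    · intro k hk
      simp only [Finset.mem_filter, Finset.mem_Icc, Finset.mem_range, Admissible, abs_le] at hk ⊢
      refine ⟨by omega, by omega, ⟨N - k, by ring⟩, by omega, by omega⟩
    · intro d hd
      simp only [Finset.mem_filter, Finset.mem_Icc, Admissible, abs_le] at hd
      obtain ⟨_, _, ⟨e, he⟩, _⟩ := hd
      omega
    · intro k _
      omega
    · intro d hd
      simp only [Finset.mem_filter, Finset.mem_Icc] at hd
      obtain ⟨hd₁, hd₂⟩ := hd
      have hd₃ := hd₂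
      simp only [Admissible, abs_le] at hd₃
      obtain ⟨_, ⟨e, he⟩, _⟩ := hd₃
      obtain ⟨k, hk⟩ := Int.eq_ofNat_of_zero_le (show 0 ≤ (b + N - d) / 2 by omega)
      rw [hk, Int.toNat_natCast]
      simp only [hg]
      rw [ih (N - k) (m - k) d b (Nat.sub_le _ _) (by omega) (by omega) hd₂ hd₁ hb₁]
      congr 2
      rw [show c - d = 2 * ((k : ℤ) - n) by omega, abs_mul, abs_two]
      ring

end Paths

end QTransform

end

/-! ### The iterated transform as a sum over tuples. -/

noncomputable section

namespace QMult

section Tuples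

variable {K : Type*} [Field K]

open QTransform

@[simp] theorem poch_zero (q : K) : poch q 0 = 1 := by simp [poch]

theorem poch_succ (q : K) (n : ℕ) : poch q (n + 1) = poch q n * (1 - q ^ (n + 1)) := by
  rw [poch, Finset.prod_range_succ, poch]

theorem gauss_mul_poch (q : K) (j l : ℕ) :
    gauss q (j + l) j * (poch q j * poch q l) = poch q (j + l) := by
  induction j with
  | zero => simp
  | succ j ih =>
    rw [show j + 1 + l = j + l + 1 by omega, poch_succ, poch_succ, ← ih]
    linear_combination poch q j * poch q l * one_sub_mul_gauss_succ_succ q (j + l) j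

theorem sum_antidiagonalTuple_succ {A : Type*} [AddCommMonoid A] (k L : ℕ)
    (f : (Fin (k + 1) → ℕ) → A) :
    ∑ n ∈ Finset.Nat.antidiagonalTuple (k + 1) L, f n = ∑ j ∈ Finset.range (L + 1),
      ∑ n ∈ Finset.Nat.antidiagonalTuple k j, f (Fin.cons (L - j) n) := by
  rw [← Finset.sum_fiberwise_of_maps_to (g := fun n => L - n 0) (t := Finset.range (L + 1))
    fun n _ => Finset.mem_range.mpr (by omega)]
  refine Finset.sum_congr rfl fun j hj => ?_
  rw [Finset.mem_range] at hj
  refine Finset.sum_bij' (fun n _ => Fin.tail n) (fun n _ => Fin.cons (L - j) n) ?_ ?_ ?_ ?_ ?_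
  · intro n hn
    rw [Finset.mem_filter, Finset.Nat.mem_antidiagonalTuple, Fin.sum_univ_succ] at hn
    rw [Finset.Nat.mem_antidiagonalTuple]
    simp only [Fin.tail]
    omega
  · intro n hn
    rw [Finset.Nat.mem_antidiagonalTuple] at hn
    rw [Finset.mem_filter, Finset.Nat.mem_antidiagonalTuple, Fin.sum_univ_succ]
    simp only [Fin.cons_zero, Fin.cons_succ, hn]
    omega
  · intro n hn
    rw [Finset.mem_filter, Finset.Nat.mem_antidiagonalTuple, Fin.sum_univ_succ] at hn
    rw [show L - j = n 0 by omega, Fin.cons_self_tail]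
  · intro n _
    exact Fin.tail_cons _ _
  · intro n hn
    rw [Finset.mem_filter, Finset.Nat.mem_antidiagonalTuple, Fin.sum_univ_succ] at hn
    rw [show L - j = n 0 by omega, Fin.cons_self_tail]

/-- The quadratic form `∑_{i,j} min(i,j) n_i n_j`. -/
def minForm {k : ℕ} (n : Fin k → ℕ) : ℕ := ∑ i : Fin k, ∑ j : Fin k, min (i : ℕ) j * (n i * n j)

theorem minForm_cons {k : ℕ} (a : ℕ) (n : Fin k → ℕ) :
    minForm (Fin.cons a n : Fin (k + 1) → ℕ) = minForm n + (∑ i, n i) ^ 2 := by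
  simp only [minForm, Fin.sum_univ_succ, Fin.cons_succ, Fin.val_zero, Fin.val_succ, Nat.zero_min,
    Nat.min_zero, zero_mul, Finset.sum_const_zero, zero_add]
  rw [pow_two, Finset.sum_mul_sum, ← Finset.sum_add_distrib]
  refine Finset.sum_congr rfl fun i _ => ?_
  rw [← Finset.sum_add_distrib]
  refine Finset.sum_congr rfl fun j _ => ?_
  rw [Nat.add_min_add_right]; ring

open Polynomial in
-- Each further transform prepends n_0 = L − j and moves the old entries up one index. This adds j
-- to ∑ i n_i and j² to the min form, as min(i+1, j+1) = min(i, j) + 1, while [L; j] supplies the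
-- new Pochhammer denominator.
theorem trans_pow_one_eq_sum {q : K} (hq : ∀ n, poch q n ≠ 0) (N L : ℕ) :
    (qTrans (C q) Polynomial.X ^ N) 1 L = ∑ n ∈ Finset.Nat.antidiagonalTuple (N + 1) L,
      Polynomial.X ^ (∑ i : Fin (N + 1), (i : ℕ) * n i) *
        C (q ^ minForm n * (poch q L * ∏ i, (poch q (n i))⁻¹)) := by
  induction N generalizing L with
  | zero =>
    suffices h : 1 = Polynomial.X ^ 0 * (C (poch q L) * C (poch q L)⁻¹) by simpa [minForm] using h
    rw [pow_zero, one_mul, ← C_mul, mul_inv_cancel₀ (hq L), C_1]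
  | succ N ih =>
    rw [pow_succ_apply', trans_apply, sum_antidiagonalTuple_succ]
    refine Finset.sum_congr rfl fun j hj => ?_
    obtain ⟨l, rfl⟩ := Nat.exists_eq_add_of_le (Nat.lt_succ_iff.mp (Finset.mem_range.mp hj))
    rw [ih, Finset.mul_sum]
    refine Finset.sum_congr rfl fun n hn => ?_
    rw [Finset.Nat.mem_antidiagonalTuple] at hn
    have h₁ : ∑ i : Fin (N + 1 + 1), (i : ℕ) * (Fin.cons (j + l - j) n : Fin (N + 1 + 1) → ℕ) i =
        j + ∑ i : Fin (N + 1), (i : ℕ) * n i := by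
      rw [Fin.sum_univ_succ]
      simp only [Fin.val_zero, zero_mul, zero_add, Fin.cons_succ, Fin.val_succ, add_mul, one_mul]
      rw [Finset.sum_add_distrib, hn, add_comm]
    have h₂ := gauss_mul_poch q j l
    rw [h₁, minForm_cons, hn, ← gauss_map, ← C_pow, pow_add, pow_add]
    have h₄ : ∏ i : Fin (N + 1 + 1), (poch q ((Fin.cons l n : Fin (N + 1 + 1) → ℕ) i))⁻¹ =
        (poch q l)⁻¹ * ∏ i, (poch q (n i))⁻¹ := by
      rw [Fin.prod_univ_succ]; rfl
    rw [Nat.add_sub_cancel_left, h₄, ← h₂]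
    have h₃ : gauss q (j + l) j * (poch q j * poch q l) *
        ((poch q l)⁻¹ * ∏ i, (poch q (n i))⁻¹) =
        gauss q (j + l) j * (poch q j * ∏ i, (poch q (n i))⁻¹) := by
      rw [← mul_inv_cancel_left₀ (hq l) (gauss q (j + l) j * (poch q j * ∏ i, (poch q (n i))⁻¹))]
      ring
    rw [h₃]
    simp only [C_mul]
    ring

theorem vcoef_zero_eq_sum {q : K} (hq₀ : q ≠ 0) (hq : ∀ n, poch q n ≠ 0) (N L : ℕ) (m : ℤ) :
    vcoef q N 0 L m = ∑ n ∈ (Finset.Nat.antidiagonalTuple (N + 1) L).filter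
      (fun n => ((∑ i : Fin (N + 1), (i : ℕ) * n i : ℕ) : ℤ) = m),
        q ^ minForm n * (poch q L * ∏ i, (poch q (n i))⁻¹) := by
  rw [vcoef, vfun, C_mul_C_inv_mul_X hq₀, pow_zero, Module.End.one_apply, Nat.sub_zero,
    trans_pow_one_eq_sum hq, coefz_sum, Finset.sum_filter]
  refine Finset.sum_congr rfl fun n _ => ?_
  rw [coefz_X_pow_mul, ← mul_one (Polynomial.C _), coefz_C_mul, coefz_one, mul_ite, mul_one,
    mul_zero]
  simp only [sub_eq_zero]
  exact if_congr eq_comm rfl rfl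

end Tuples

/-! ### The inverse Cartan matrix. -/

section Cartan

theorem cartan_mulVec {N : ℕ} (hN : 1 ≤ N) (g : ℕ → ℚ) (h₀ : g 0 = 0) (h₁ : g N = 0)
    (i : Fin (N - 1)) :
    (cartan N).mulVec (fun j => g (j + 1)) i = 2 * g (i + 1) - g i - g (i + 2) := by
  have h : ∀ j : Fin (N - 1), cartan N i j * g (j + 1) = (if i = j then 2 * g (j + 1) else 0) -
      (if (j : ℕ) + 1 = i then g (j + 1) else 0) -
      (if (j : ℕ) = i + 1 then g (j + 1) else 0) := by
    intro j
    simp only [cartan, CartanMatrix.A, Matrix.map_apply, Matrix.of_apply, Fin.ext_iff]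
    split_ifs <;> first | omega | (push_cast; ring)
  rw [Matrix.mulVec, dotProduct, Finset.sum_congr rfl fun j _ => h j, Finset.sum_sub_distrib,
    Finset.sum_sub_distrib, Finset.sum_ite_eq]
  simp only [Finset.mem_univ, if_true]
  congr 1
  · congr 1
    by_cases hi : (i : ℕ) = 0
    · rw [hi, h₀]
      exact Finset.sum_eq_zero fun j _ => if_neg (by omega)
    · rw [Finset.sum_eq_single ⟨i - 1, by omega⟩]
      · rw [if_pos (by simp only; omega)]
        congr 1
        simp only
        omega
      · intro j _ hj
        refine if_neg fun h => hj (Fin.ext ?_)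
        simp only
        omega
      · simp
  · by_cases hi : (i : ℕ) + 2 = N
    · rw [hi, h₁]
      exact Finset.sum_eq_zero fun j _ => if_neg (by omega)
    · rw [Finset.sum_eq_single ⟨i + 1, by omega⟩]
      · simp
      · intro j _ hj
        refine if_neg fun h => hj (Fin.ext ?_)
        simpa using h
      · simp

/-- C acts as the negative second difference with zero boundary values; its Green function is
piecewise linear with one kink, namely min(i, j) − ij/N. -/
theorem cartan_inv {N : ℕ} (hN : 1 ≤ N) :
    (cartan N)⁻¹ = Matrix.of fun i j : Fin (N - 1) =>
      ((min ((i : ℕ) + 1) (j + 1) : ℕ) : ℚ) - ((i : ℕ) + 1) * ((j : ℕ) + 1) / N := by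
  have hN' : (N : ℚ) ≠ 0 := by positivity
  refine Matrix.inv_eq_right_inv ?_
  ext i k
  have h := cartan_mulVec hN
    (fun j => ((min j (k + 1) : ℕ) : ℚ) - (j : ℚ) * ((k : ℕ) + 1) / N) (by simp)
    (by rw [min_eq_right (by omega)]; push_cast; field_simp; ring) i
  rw [Matrix.mul_apply]
  simp only [Matrix.mulVec, dotProduct, Matrix.of_apply] at h ⊢
  push_cast at h ⊢
  rw [h, Matrix.one_apply]
  split_ifs with hik
  · subst hik
    rw [min_eq_left (by linarith), min_eq_left (by linarith), min_eq_right (by linarith)]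
    ring
  · rw [Fin.ext_iff] at hik
    rcases Nat.lt_or_gt_of_ne hik with hlt | hlt
    · have : ((i : ℕ) : ℚ) + 1 ≤ (k : ℕ) := by exact_mod_cast hlt
      rw [min_eq_left (by linarith), min_eq_left (by linarith), min_eq_left (by linarith)]
      ring
    · have : ((k : ℕ) : ℚ) + 1 ≤ (i : ℕ) := by exact_mod_cast hlt
      rw [min_eq_right (by linarith), min_eq_right (by linarith), min_eq_right (by linarith)]
      ring

theorem cinv_eq {N : ℕ} (hN : 1 ≤ N) (x : Fin (N - 1) → ℚ) {i : ℕ} (hi : i ≤ N) :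
    cinv N x i = ∑ j : Fin (N - 1), (((min i ((j : ℕ) + 1) : ℕ) : ℚ) - i * ((j : ℕ) + 1) / N) * x j := by
  have hN' : (N : ℚ) ≠ 0 := by positivity
  rw [cinv]
  split_ifs with h
  · rw [cartan_inv hN, Matrix.mulVec, dotProduct]
    refine Finset.sum_congr rfl fun j _ => ?_
    have : (((i - 1 : ℕ) : ℚ) + 1) = i := by
      rw [Nat.cast_sub h.1]; push_cast; ring
    simp only [Matrix.of_apply]
    rw [this, Nat.sub_add_cancel h.1]
  · refine (Finset.sum_eq_zero fun j _ => ?_).symm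
    rcases (by omega : i = 0 ∨ i = N) with rfl | rfl
    · simp
    · rw [min_eq_right (by omega)]
      push_cast
      field_simp
      ring

theorem cinv_one {N : ℕ} (hN : 1 ≤ N) (x : Fin (N - 1) → ℚ) :
    cinv N x 1 = ∑ j, x j - (∑ j : Fin (N - 1), ((j : ℕ) + 1) * x j) / N := by
  rw [cinv_eq hN x hN, Finset.sum_div, ← Finset.sum_sub_distrib]
  refine Finset.sum_congr rfl fun j _ => ?_
  rw [min_eq_left (by omega)]
  push_cast
  ring

theorem cinv_sub_one {N : ℕ} (hN : 1 ≤ N) (x : Fin (N - 1) → ℚ) :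
    cinv N x (N - 1) = (∑ j : Fin (N - 1), ((j : ℕ) + 1) * x j) / N := by
  have hN' : (N : ℚ) ≠ 0 := by positivity
  rw [cinv_eq hN x (Nat.sub_le N 1), Finset.sum_div]
  refine Finset.sum_congr rfl fun j _ => ?_
  rw [min_eq_right (by omega), Nat.cast_sub hN]
  push_cast
  field_simp
  ring

theorem quad_eq {N : ℕ} (hN : 1 ≤ N) (x : Fin (N - 1) → ℚ) :
    quad N x = ∑ i : Fin (N - 1), ∑ j : Fin (N - 1), ((min ((i : ℕ) + 1) (j + 1) : ℕ) : ℚ) * (x i * x j) -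
      (∑ j : Fin (N - 1), ((j : ℕ) + 1) * x j) ^ 2 / N := by
  rw [quad, cartan_inv hN, dotProduct, pow_two, Finset.sum_mul_sum, Finset.sum_div,
    ← Finset.sum_sub_distrib]
  refine Finset.sum_congr rfl fun i _ => ?_
  rw [Matrix.mulVec, dotProduct, Finset.mul_sum, Finset.sum_div, ← Finset.sum_sub_distrib]
  refine Finset.sum_congr rfl fun j _ => ?_
  simp only [Matrix.of_apply]
  ring

/-- Linear interpolation between the boundary values A and B solves the system for η = 0; the rest
is the response to −2η. The formula includes i = 0 and i = N, which covers N = 1. -/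
theorem mu_eq {N : ℕ} (hN : 1 ≤ N) (A B : ℤ) (η : Fin (N - 1) → ℤ) {i : ℕ} (hi : i ≤ N) :
    mu N A B η i = A - i * ((A : ℚ) - B) / N - 2 * cinv N (toRat η) i := by
  have hN' : (N : ℚ) ≠ 0 := by positivity
  rw [mu]
  split_ifs with h₀ h₁
  · simp [h₀, cinv]
  · subst h₁
    rw [cinv, dif_neg (by omega)]
    field_simp
    ring
  · rw [cinv_eq hN _ hi, cinv_eq hN _ hi]
    have e₁ : ∑ j : Fin (N - 1), (if (j : ℕ) = 0 then
        (((min i ((j : ℕ) + 1) : ℕ) : ℚ) - i * ((j : ℕ) + 1) / N) * A else 0) =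
        (1 - (i : ℚ) / N) * A := by
      rw [Finset.sum_eq_single ⟨0, by omega⟩]
      · simp only [if_true]
        rw [min_eq_right (by omega)]
        simp
      · intro j _ hj
        exact if_neg fun h => hj (Fin.ext h)
      · simp
    have e₂ : ∑ j : Fin (N - 1), (if (j : ℕ) + 1 = N - 1 then
        (((min i ((j : ℕ) + 1) : ℕ) : ℚ) - i * ((j : ℕ) + 1) / N) * B else 0) =
        (i : ℚ) / N * B := by
      rw [Finset.sum_eq_single ⟨N - 2, by omega⟩]
      · simp only
        rw [if_pos (by omega), show N - 2 + 1 = N - 1 by omega, min_eq_left (by omega),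
          Nat.cast_sub (show 2 ≤ N by omega)]
        push_cast
        field_simp
        ring
      · intro j _ hj
        refine if_neg fun h => hj (Fin.ext ?_)
        simp only
        omega
      · simp
    have e₃ : ∀ j : Fin (N - 1),
        (((min i ((j : ℕ) + 1) : ℕ) : ℚ) - i * ((j : ℕ) + 1) / N) * source N A B η j =
        (if (j : ℕ) = 0 then (((min i ((j : ℕ) + 1) : ℕ) : ℚ) - i * ((j : ℕ) + 1) / N) * A else 0) +
        (if (j : ℕ) + 1 = N - 1 then
          (((min i ((j : ℕ) + 1) : ℕ) : ℚ) - i * ((j : ℕ) + 1) / N) * B else 0) -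
        2 * ((((min i ((j : ℕ) + 1) : ℕ) : ℚ) - i * ((j : ℕ) + 1) / N) * (η j : ℚ)) := by
      intro j
      simp only [source]
      split_ifs <;> ring
    rw [Finset.sum_congr rfl fun j _ => e₃ j, Finset.sum_sub_distrib, Finset.sum_add_distrib, e₁, e₂,
      ← Finset.mul_sum]
    simp only [toRat]
    ring

end Cartan

end QMult

end

/-! ### The q-multinomial as a coefficient of the iterated transform. -/

noncomputable section

namespace QMult

section EtaSet

/-- The middle part `(n_1, …, n_{N-1})` of `(n_0, …, n_N)`, with `N = M + 1`. -/
def middle {M : ℕ} (n : Fin (M + 1 + 1) → ℕ) : Fin (M + 1 - 1) → ℤ :=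
  fun i : Fin M => (n i.castSucc.succ : ℤ)

/-- The tuples `(n_0, …, n_N)` with `∑ n_i = L` and `∑ i n_i = m`. -/
def tuples (M L : ℕ) (m : ℤ) : Finset (Fin (M + 1 + 1) → ℕ) :=
  (Finset.Nat.antidiagonalTuple (M + 1 + 1) L).filter
    (fun n => ((∑ i : Fin (M + 1 + 1), (i : ℕ) * n i : ℕ) : ℤ) = m)

/-- The vectors `η` that contribute to `T_0^{(N)}(L, m - NL/2)`, with `N = M + 1`. -/
def etaSet (M L : ℕ) (m : ℤ) : Finset (Fin (M + 1 - 1) → ℤ) :=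
  open Classical in (tuples M L m).image middle

variable {M : ℕ}

theorem sum_eq_middle (n : Fin (M + 1 + 1) → ℕ) :
    ((∑ i, n i : ℕ) : ℤ) =
      n 0 + (∑ i : Fin (M + 1 - 1), middle n i + n (Fin.last (M + 1))) := by
  rw [Fin.sum_univ_succ, Fin.sum_univ_castSucc, Fin.succ_last]
  push_cast
  rfl

theorem weighted_sum_eq_middle (n : Fin (M + 1 + 1) → ℕ) :
    ((∑ i : Fin (M + 1 + 1), (i : ℕ) * n i : ℕ) : ℤ) =
      ∑ i : Fin (M + 1 - 1), (((i : ℕ) : ℤ) + 1) * middle n i +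
        (M + 1) * n (Fin.last (M + 1)) := by
  rw [Fin.sum_univ_succ, Fin.sum_univ_castSucc, Fin.succ_last]
  simp only [Fin.val_zero, zero_mul, zero_add, Fin.val_succ, Fin.val_castSucc, Fin.val_last]
  push_cast
  rfl

theorem mem_tuples {L : ℕ} {m : ℤ} {n : Fin (M + 1 + 1) → ℕ} :
    n ∈ tuples M L m ↔
      (n 0 + (∑ i : Fin (M + 1 - 1), middle n i + n (Fin.last (M + 1))) : ℤ) = L ∧
        ∑ i : Fin (M + 1 - 1), (((i : ℕ) : ℤ) + 1) * middle n i +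
          (M + 1) * n (Fin.last (M + 1)) = m := by
  rw [tuples, Finset.mem_filter, Finset.Nat.mem_antidiagonalTuple, weighted_sum_eq_middle,
    ← sum_eq_middle, Nat.cast_inj]

theorem cinv_one_middle {L : ℕ} {m : ℤ} {n : Fin (M + 1 + 1) → ℕ} (hn : n ∈ tuples M L m) :
    (n 0 : ℚ) = L - m / ((M + 1 : ℕ) : ℚ) - cinv (M + 1) (toRat (middle n)) 1 := by
  obtain ⟨h₁, h₂⟩ := mem_tuples.mp hn
  have h₀ : ((M : ℚ) + 1) ≠ 0 := by positivity
  replace h₁ := congrArg (Int.cast : ℤ → ℚ) h₁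
  replace h₂ := congrArg (Int.cast : ℤ → ℚ) h₂
  rw [cinv_one (Nat.succ_pos M)]
  simp only [toRat]
  push_cast at h₁ h₂ ⊢
  rw [← h₁, ← h₂]
  field_simp
  ring

theorem cinv_last_middle {L : ℕ} {m : ℤ} {n : Fin (M + 1 + 1) → ℕ} (hn : n ∈ tuples M L m) :
    (n (Fin.last (M + 1)) : ℚ) =
      m / ((M + 1 : ℕ) : ℚ) - cinv (M + 1) (toRat (middle n)) (M + 1 - 1) := by
  obtain ⟨-, h₂⟩ := mem_tuples.mp hn
  have h₀ : ((M : ℚ) + 1) ≠ 0 := by positivity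
  replace h₂ := congrArg (Int.cast : ℤ → ℚ) h₂
  rw [cinv_sub_one (Nat.succ_pos M)]
  simp only [toRat]
  push_cast at h₂ ⊢
  rw [← h₂]
  field_simp
  ring

/-- The outer entries n_0 and n_N are determined by η, L and m, and are the indices of the two outer
Pochhammer symbols in T_0. Conversely, natural values of these expressions, placed around η, rebuild
the tuple. -/
theorem mem_etaSet {L : ℕ} {m : ℤ} {η : Fin (M + 1 - 1) → ℤ} :
    η ∈ etaSet M L m ↔ (∀ i, 0 ≤ η i) ∧
      (∃ α : ℕ, (α : ℚ) = L - m / ((M + 1 : ℕ) : ℚ) - cinv (M + 1) (toRat η) 1) ∧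
      ∃ β : ℕ, (β : ℚ) =
        m / ((M + 1 : ℕ) : ℚ) - cinv (M + 1) (toRat η) (M + 1 - 1) := by
  classical
  rw [etaSet, Finset.mem_image]
  constructor
  · rintro ⟨n, hn, rfl⟩
    exact ⟨fun i => Int.natCast_nonneg _, ⟨_, cinv_one_middle hn⟩, _, cinv_last_middle hn⟩
  · rintro ⟨h₀, ⟨α, hα⟩, β, hβ⟩
    have hM : ((M : ℚ) + 1) ≠ 0 := by positivity
    let η' : Fin M → ℕ := fun i => (η i).toNat
    let n : Fin (M + 1 + 1) → ℕ := Fin.cons α (Fin.snoc η' β : Fin (M + 1) → ℕ)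
    have e₁ : middle n = η := by
      funext i
      change ((n (Fin.castSucc i).succ : ℕ) : ℤ) = _
      simp only [n, Fin.cons_succ]
      rw [Fin.snoc_castSucc]
      exact Int.toNat_of_nonneg (h₀ i)
    have e₂ : n 0 = α := rfl
    have e₃ : n (Fin.last (M + 1)) = β := by
      rw [← Fin.succ_last]
      simp only [n, Fin.cons_succ, Fin.snoc_last]
    refine ⟨n, mem_tuples.mpr ?_, e₁⟩
    rw [e₁, e₂, e₃]
    rw [cinv_one (Nat.succ_pos M)] at hα
    rw [cinv_sub_one (Nat.succ_pos M)] at hβ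
    simp only [toRat] at hα hβ
    push_cast at hα hβ
    have h₂ : (∑ i : Fin (M + 1 - 1), (((i : ℕ) : ℚ) + 1) * η i) + (M + 1) * β = m := by
      rw [hβ]; field_simp; ring
    refine ⟨?_, by exact_mod_cast h₂⟩
    have h₁ : (α + (∑ i : Fin (M + 1 - 1), (η i : ℚ) + β) : ℚ) = L := by
      rw [hα, hβ]; ring
    exact_mod_cast h₁

theorem middle_injOn (L : ℕ) (m : ℤ) : Set.InjOn (middle (M := M)) (tuples M L m) := by
  intro n hn n' hn' h
  have h₁ := cinv_one_middle hn
  have h₂ := cinv_last_middle hn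
  rw [h, ← cinv_one_middle hn', Nat.cast_inj] at h₁
  rw [h, ← cinv_last_middle hn', Nat.cast_inj] at h₂
  funext i
  refine Fin.cases h₁ (fun i => ?_) i
  refine Fin.lastCases ?_ (fun i => ?_) i
  · rw [Fin.succ_last]; exact h₂
  · exact Int.natCast_inj.mp (congrFun h i)

end EtaSet

section Multinomial

variable {K : Type*} [Field K]

theorem invPoch_natCast (q : K) (n : ℕ) : invPoch q n = (poch q n)⁻¹ := by
  simp [invPoch]

theorem exists_nat_of_invPoch_ne_zero {q : K} {x : ℚ} (h : invPoch q x ≠ 0) :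
    ∃ n : ℕ, (n : ℚ) = x := by
  rw [invPoch] at h
  exact ⟨_, (ite_ne_right_iff.mp h).1⟩

theorem multinomial_eq_sum (t : K) (M L : ℕ) {a : ℚ} {m : ℤ}
    (hm : (m : ℚ) = ((M + 1 : ℕ) : ℚ) * L / 2 + a) :
    multinomial (M + 1) t 0 L a = ∑ η ∈ etaSet M L m,
      qpow (M + 1) t (quad (M + 1) (toRat η)) * poch (base (M + 1) t) L *
        invPoch (base (M + 1) t) (L - m / ((M + 1 : ℕ) : ℚ) - cinv (M + 1) (toRat η) 1) *
        invPoch (base (M + 1) t) (m / ((M + 1 : ℕ) : ℚ) - cinv (M + 1) (toRat η) (M + 1 - 1)) *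
        ∏ i, invPoch (base (M + 1) t) (η i : ℚ) := by
  have hM : (((M + 1 : ℕ) : ℚ)) ≠ 0 := by positivity
  have e₁ : (L : ℚ) / 2 + a / ((M + 1 : ℕ) : ℚ) = m / ((M + 1 : ℕ) : ℚ) := by
    rw [hm]; field_simp
  have e₂ : (L : ℚ) / 2 - a / ((M + 1 : ℕ) : ℚ) = L - m / ((M + 1 : ℕ) : ℚ) := by
    rw [← e₁]; ring
  have e₃ : ∀ η : Fin (M + 1 - 1) → ℤ, cinv (M + 1) (toRat η) 0 = 0 := fun η => by simp [cinv]
  classical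
  rw [multinomial, finsum_eq_sum_of_support_subset (s := etaSet M L m)]
  · refine Finset.sum_congr rfl fun η hη => ?_
    obtain ⟨-, ⟨α, hα⟩, -⟩ := mem_etaSet.mp hη
    -- The congruence on η is automatic here: the expression equals L − α.
    have hc : ∃ z : ℤ, (L : ℚ) / 2 + a / ((M + 1 : ℕ) : ℚ) +
        cinv (M + 1) (toRat η) 1 = z := by
      refine ⟨(L : ℤ) - α, ?_⟩
      rw [e₁]
      push_cast at hα ⊢
      linarith
    rw [if_pos hc, e₁, e₂, e₃, sub_zero]
  · intro η hη
    rw [Function.mem_support] at hη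
    have h := (ite_ne_right_iff.mp hη).2
    rw [e₁, e₂] at h
    refine Finset.mem_coe.mpr (mem_etaSet.mpr ⟨fun i => ?_, ?_, ?_⟩)
    · obtain ⟨k, hk⟩ := exists_nat_of_invPoch_ne_zero
        (Finset.prod_ne_zero_iff.mp (right_ne_zero_of_mul h) i (Finset.mem_univ i))
      have : η i = k := by exact_mod_cast hk.symm
      omega
    · exact exists_nat_of_invPoch_ne_zero
        (right_ne_zero_of_mul (left_ne_zero_of_mul (left_ne_zero_of_mul h)))
    · exact exists_nat_of_invPoch_ne_zero (right_ne_zero_of_mul (left_ne_zero_of_mul h))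

theorem minForm_eq_middle {M : ℕ} (n : Fin (M + 1 + 1) → ℕ) :
    (minForm n : ℤ) = ∑ i : Fin (M + 1 - 1), ∑ j : Fin (M + 1 - 1),
        ((min ((i : ℕ) + 1) (j + 1) : ℕ) : ℤ) * (middle n i * middle n j) +
      2 * n (Fin.last (M + 1)) * (∑ i : Fin (M + 1 - 1), (((i : ℕ) : ℤ) + 1) * middle n i) +
      (M + 1) * n (Fin.last (M + 1)) ^ 2 := by
  have h : ∀ i : Fin M, min ((i : ℕ) + 1) (M + 1) = i + 1 := fun i => min_eq_left (by omega)
  have h' : ∀ i : Fin M, min (M + 1) ((i : ℕ) + 1) = i + 1 := fun i => min_eq_right (by omega)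
  rw [minForm, Fin.sum_univ_succ, Fin.sum_univ_castSucc]
  simp only [Fin.sum_univ_succ (n := M + 1), Fin.sum_univ_castSucc, Fin.val_zero, Nat.zero_min,
    Nat.min_zero, zero_mul, Finset.sum_const_zero, zero_add, Fin.val_succ, Fin.val_castSucc,
    Fin.val_last, Fin.succ_last, h, h', min_self, Finset.sum_add_distrib]
  push_cast
  have e₁ : ∑ i : Fin M, (((i : ℕ) : ℤ) + 1) *
      ((n i.castSucc.succ : ℤ) * (n (Fin.last (M + 1)) : ℤ)) =
      n (Fin.last (M + 1)) * ∑ i : Fin M, (((i : ℕ) : ℤ) + 1) * n i.castSucc.succ := by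
    rw [Finset.mul_sum]; exact Finset.sum_congr rfl fun _ _ => by ring
  have e₂ : ∑ i : Fin M, (((i : ℕ) : ℤ) + 1) *
      ((n (Fin.last (M + 1)) : ℤ) * (n i.castSucc.succ : ℤ)) =
      n (Fin.last (M + 1)) * ∑ i : Fin M, (((i : ℕ) : ℤ) + 1) * n i.castSucc.succ := by
    rw [Finset.mul_sum]; exact Finset.sum_congr rfl fun _ _ => by ring
  rw [e₁, e₂]
  change _ = ∑ i : Fin M, ∑ j : Fin M, (min (((i : ℕ) : ℤ) + 1) (((j : ℕ) : ℤ) + 1)) *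
      ((n i.castSucc.succ : ℤ) * (n j.castSucc.succ : ℤ)) +
      2 * (n (Fin.last (M + 1)) : ℤ) *
        (∑ i : Fin M, (((i : ℕ) : ℤ) + 1) * (n i.castSucc.succ : ℤ)) +
      (M + 1) * (n (Fin.last (M + 1)) : ℤ) ^ 2
  ring

open QTransform in
/-- The `q`-multinomial coefficient as a coefficient of the iterated transform. -/
theorem multinomial_eq_vcoef {t : K} (ht : t ≠ 0) {N : ℕ} (hN : 1 ≤ N)
    (hq : ∀ n, poch (base N t) n ≠ 0) (L : ℕ) {a : ℚ} {m : ℤ} (hm : (m : ℚ) = N * L / 2 + a) :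
    multinomial N t 0 L a = t ^ (-4 * m ^ 2) * vcoef (base N t) N 0 L m := by
  obtain ⟨M, rfl⟩ := Nat.exists_eq_add_of_le' hN
  have hM : ((M : ℚ) + 1) ≠ 0 := by positivity
  have hb : base (M + 1) t ≠ 0 := pow_ne_zero _ ht
  classical
  rw [multinomial_eq_sum t M L hm, vcoef_zero_eq_sum hb hq, etaSet,
    Finset.sum_image (middle_injOn L m), Finset.mul_sum]
  refine Finset.sum_congr rfl fun n hn => ?_
  obtain ⟨-, h₂⟩ := mem_tuples.mp hn
  -- Completing the square: with m = ∑ i η_i + N n_N, the min form equals ηC⁻¹η + m²/N.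
  have hquad : 4 * ((M + 1 : ℕ) : ℚ) * quad (M + 1) (toRat (middle n)) =
      ((-4 * m ^ 2 + 4 * (M + 1 : ℕ) * minForm n : ℤ) : ℚ) := by
    have h₁ := minForm_eq_middle n
    replace h₁ := congrArg (Int.cast : ℤ → ℚ) h₁
    replace h₂ := congrArg (Int.cast : ℤ → ℚ) h₂
    rw [quad_eq (Nat.succ_pos M)]
    simp only [toRat]
    push_cast at h₁ h₂ ⊢
    rw [h₁, ← h₂]
    field_simp
    ring
  have hprod : ∏ i : Fin (M + 1 - 1), invPoch (base (M + 1) t) (middle n i : ℚ) =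
      ∏ i : Fin M, (poch (base (M + 1) t) (n i.castSucc.succ))⁻¹ :=
    Finset.prod_congr rfl fun i _ => by
      rw [← invPoch_natCast]; rfl
  rw [← cinv_one_middle hn, ← cinv_last_middle hn, invPoch_natCast, invPoch_natCast, hprod,
    Fin.prod_univ_succ, Fin.prod_univ_castSucc, Fin.succ_last, qpow_eq _ _ hquad, zpow_add₀ ht]
  have hpow : t ^ (4 * ((M + 1 : ℕ) : ℤ) * (minForm n : ℤ)) =
      base (M + 1) t ^ minForm n := by
    rw [base, ← pow_mul, ← zpow_natCast]
    push_cast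
    rfl
  rw [hpow]
  ring

end Multinomial

end QMult

end

/-! ### Part (b), and limits of q-binomials. -/

noncomputable section

namespace QMult

section PartTwo

variable {K : Type*} [Field K]

open QTransform in
/-- The alternating sum of `q`-multinomials is a one-dimensional configuration sum. -/
theorem bosonicSum_eq_configSum {t : K} (ht : t ≠ 0) {N : ℕ} (hN : 1 ≤ N)
    (hq : ∀ n, poch (base N t) n ≠ 0) {p P r s D m : ℤ} (L : ℕ)
    (hm : 2 * m = N * L + r + D - s) (hP : P = p + N) (h₁ : 1 ≤ r + D) (h₂ : r + D ≤ p - 1)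
    (h₃ : 1 ≤ s) (h₄ : s ≤ P - 1) :
    qpow N t (((s : ℚ) - (r + D)) * (s - (r + D) - N) / (4 * N)) * bosonicSum N t p P r s D L =
      configSum N t P L s (r + D) (r + D + N) := by
  have hN' : (N : ℚ) ≠ 0 := by positivity
  have hr : r = 2 * m + s - N * L - D := by linarith
  have hbase : base N t = (t ^ N) ^ 4 := by rw [base, ← pow_mul, mul_comm]
  -- n = 0 because the final step ρ → ρ + N is the maximal one.
  rw [configSum_eq_altSum ht ⟨h₃, h₄⟩ L 0 m (r + D) (r + D + N) (Nat.zero_le N)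
    (by rw [hr]; ring) (by simp) ?_ ⟨h₁, by omega⟩ ⟨by omega, by omega⟩]
  · rw [bosonicSum, mul_finsum, altSum]
    refine finsum_congr fun j => ?_
    have hqmul : ((m + P * j : ℤ) : ℚ) = N * L / 2 + (1 / 2 * ((r : ℚ) + D - s) + P * j) := by
      rw [hr]; push_cast; ring
    have hqmul' : ((m + s + P * j : ℤ) : ℚ) =
        N * L / 2 + (1 / 2 * ((r : ℚ) + D + s) + P * j) := by
      rw [hr]; push_cast; ring
    rw [multinomial_eq_vcoef ht hN hq L hqmul, multinomial_eq_vcoef ht hN hq L hqmul',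
      qpow_eq N t (z := (s - (r + D)) * (s - (r + D) - N)) (by push_cast; field_simp),
      qpow_eq N t (z := 4 * j * (p * P * j + P * (D + r) - p * s)) (by push_cast; field_simp),
      qpow_eq N t (z := 4 * (p * j + D + r) * (P * j + s)) (by push_cast; field_simp),
      pathGF, pathGF, hbase, mul_sub]
    simp only [← zpow_natCast t N, ← zpow_mul]
    simp only [← mul_assoc, ← zpow_add₀ ht]
    have hp : p = P - N := by linarith
    congr 3
    · rw [hr, hp]; push_cast; ring
    · rw [hr, hp]; push_cast; ring
  · refine ⟨?_, ⟨0, by ring⟩, by omega, by omega⟩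
    rw [show r + D - (r + D + N) = -(N : ℤ) by ring, abs_neg, Nat.abs_cast]

end PartTwo

section Limits

variable {K : Type*} [Field K]

theorem poch_ne_zero {q : K} (h : ∀ n : ℕ, q ^ (n + 1) ≠ 1) (n : ℕ) : poch q n ≠ 0 :=
  Finset.prod_ne_zero_iff.mpr fun k _ => sub_ne_zero.mpr (h k).symm

theorem poch_add (q : K) (n c : ℕ) :
    poch q (n + c) = poch q n * ∏ k ∈ Finset.range c, (1 - q ^ n * q ^ (k + 1)) := by
  rw [poch, Finset.prod_range_add, poch]
  congr 1
  refine Finset.prod_congr rfl fun k _ => ?_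
  rw [← pow_add, add_assoc]

theorem qbinom_natCast_left (q : K) (n c : ℕ) :
    qbinom q ((n : ℚ) + c) n = poch q (n + c) / (poch q n * poch q c) := by
  have h : ⌊(n : ℚ) + c⌋₊ = n + c := by rw [← Nat.cast_add, Nat.floor_natCast]
  simp [qbinom, h]

theorem qbinom_natCast_right (q : K) (n c : ℕ) :
    qbinom q ((n : ℚ) + c) c = poch q (n + c) / (poch q n * poch q c) := by
  have h : ⌊(n : ℚ) + c⌋₊ = n + c := by rw [← Nat.cast_add, Nat.floor_natCast]
  simp [qbinom, h, mul_comm]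

theorem exists_nat_of_qbinom_ne_zero {q : K} {A B : ℚ} (h : qbinom q A B ≠ 0) :
    (∃ n : ℕ, (n : ℚ) = B) ∧ ∃ n : ℕ, (n : ℚ) = A - B := by
  rw [qbinom] at h
  obtain ⟨h₁, h₂⟩ := (ite_ne_right_iff.mp h).1
  exact ⟨⟨_, h₁⟩, _, h₂⟩

variable [TopologicalSpace K]

theorem pow_succ_ne_one [T2Space K] {t : K} (ht : Tendsto (fun n : ℕ => t ^ n) atTop (𝓝 0))
    (n : ℕ) : t ^ (n + 1) ≠ 1 := by
  intro h
  have h₁ : Tendsto (fun k : ℕ => (n + 1) * k) atTop atTop :=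
    tendsto_id.const_mul_atTop' (Nat.succ_pos n)
  have h₂ := ht.comp h₁
  have h₃ : ((fun n : ℕ => t ^ n) ∘ fun k : ℕ => (n + 1) * k) = fun _ => (1 : K) := by
    funext k
    simp [pow_mul, h]
  rw [h₃] at h₂
  exact one_ne_zero (tendsto_nhds_unique tendsto_const_nhds h₂)

variable [IsTopologicalDivisionRing K]

/-- The ratio (q)_{n+c}/(q)_n is a product of c factors tending to 1, so convergence of (q)_n
itself, and completeness of K, play no role. -/
theorem tendsto_poch_ratio {q : K} (hq : ∀ n, poch q n ≠ 0)
    (h : Tendsto (fun n : ℕ => q ^ n) atTop (𝓝 0)) (c : ℕ) :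
    Tendsto (fun n => poch q (n + c) / (poch q n * poch q c)) atTop (𝓝 (poch q c)⁻¹) := by
  have h₁ : Tendsto (fun n : ℕ => ∏ k ∈ Finset.range c, (1 - q ^ n * q ^ (k + 1))) atTop
      (𝓝 (∏ k ∈ Finset.range c, (1 - 0 * q ^ (k + 1)))) :=
    tendsto_finsetProd _ fun k _ => tendsto_const_nhds.sub (h.mul tendsto_const_nhds)
  have h₂ := h₁.mul_const (poch q c)⁻¹
  simp only [zero_mul, sub_zero, Finset.prod_const_one, one_mul] at h₂
  refine h₂.congr fun n => ?_
  rw [poch_add, mul_div_mul_left _ _ (hq n), div_eq_mul_inv]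

theorem tendsto_qbinom_left {q : K} (hq : ∀ n, poch q n ≠ 0)
    (h : Tendsto (fun n : ℕ => q ^ n) atTop (𝓝 0)) (c : ℕ) {f : ℤ → ℤ}
    (hf : Tendsto f atTop atTop) :
    Tendsto (fun M => qbinom q ((f M : ℚ) + c) (f M)) atTop (𝓝 (poch q c)⁻¹) := by
  have hf' : Tendsto (fun M => (f M).toNat) atTop atTop :=
    tendsto_atTop.mpr fun b => (hf.eventually_ge_atTop (b : ℤ)).mono fun M hM => by omega
  refine ((tendsto_poch_ratio hq h c).comp hf').congr' ?_
  filter_upwards [hf.eventually_ge_atTop 0] with M hM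
  obtain ⟨n, hn⟩ := Int.eq_ofNat_of_zero_le hM
  simp only [Function.comp, hn, Int.toNat_natCast]
  exact (qbinom_natCast_left q n c).symm

theorem tendsto_qbinom_right {q : K} (hq : ∀ n, poch q n ≠ 0)
    (h : Tendsto (fun n : ℕ => q ^ n) atTop (𝓝 0)) (c : ℕ) {f : ℤ → ℤ}
    (hf : Tendsto f atTop atTop) :
    Tendsto (fun M => qbinom q ((f M : ℚ) + c) c) atTop (𝓝 (poch q c)⁻¹) := by
  have hf' : Tendsto (fun M => (f M).toNat) atTop atTop :=
    tendsto_atTop.mpr fun b => (hf.eventually_ge_atTop (b : ℤ)).mono fun M hM => by omega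
  refine ((tendsto_poch_ratio hq h c).comp hf').congr' ?_
  filter_upwards [hf.eventually_ge_atTop 0] with M hM
  obtain ⟨n, hn⟩ := Int.eq_ofNat_of_zero_le hM
  simp only [Function.comp, hn, Int.toNat_natCast]
  exact (qbinom_natCast_right q n c).symm

end Limits

/-! ### Termwise limits of the η-sums. -/

section EtaSum

variable {K : Type*} [Field K]

/-- After inserting μ, the excess of each upper entry over A or B no longer involves A + B. The
hypotheses say that these excesses are the ones in T_0, so the same finite index set serves for all
A, B. -/
theorem etaSum_eq_sum (t : K) (M L : ℕ) {σ A B m : ℤ} {u v : ℚ}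
    (h₁ : u - ((A : ℚ) + B) / 2 - ((A : ℚ) - B) / (2 * (M + 1 : ℕ)) = L - m / (M + 1 : ℕ))
    (h₂ : v - ((A : ℚ) + B) / 2 + ((A : ℚ) - B) / (2 * (M + 1 : ℕ)) = m / (M + 1 : ℕ))
    (h₃ : ∃ z : ℤ, ((A : ℚ) - B + σ * (M + 1 : ℕ)) / (2 * (M + 1 : ℕ)) = m / (M + 1 : ℕ) + z) :
    etaSum (M + 1) t σ A B u v = ∑ η ∈ etaSet M L m,
      qpow (M + 1) t (quad (M + 1) (toRat η)) *
        (∏ i : Fin (M + 1 - 1),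
          qbinom (base (M + 1) t) (mu (M + 1) A B η (i + 1) + η i) (η i)) *
        qbinom (base (M + 1) t) (A + (L - m / (M + 1 : ℕ) - cinv (M + 1) (toRat η) 1)) A *
        qbinom (base (M + 1) t) (B + (m / (M + 1 : ℕ) - cinv (M + 1) (toRat η) (M + 1 - 1)))
          B := by
  have hM : (((M + 1 : ℕ) : ℚ)) ≠ 0 := by positivity
  have e₁ : ∀ η, u - (B - mu (M + 1) A B η 1) / 2 =
      A + (L - m / (M + 1 : ℕ) - cinv (M + 1) (toRat η) 1) := fun η => by
    rw [mu_eq (Nat.succ_pos M) A B η (Nat.succ_pos M), ← h₁]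
    push_cast
    field_simp
    ring
  have e₂ : ∀ η, v - (A - mu (M + 1) A B η (M + 1 - 1)) / 2 =
      B + (m / (M + 1 : ℕ) - cinv (M + 1) (toRat η) (M + 1 - 1)) := fun η => by
    rw [mu_eq (Nat.succ_pos M) A B η (Nat.sub_le _ _), ← h₂, Nat.add_sub_cancel]
    push_cast at hM ⊢
    field_simp
    ring
  classical
  rw [etaSum, finsum_eq_sum_of_support_subset (s := etaSet M L m)]
  · refine Finset.sum_congr rfl fun η hη => ?_
    obtain ⟨-, ⟨α, hα⟩, -⟩ := mem_etaSet.mp hη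
    have hc : ∃ z : ℤ, ((A : ℚ) - B + σ * (M + 1 : ℕ)) / (2 * (M + 1 : ℕ)) +
        cinv (M + 1) (toRat η) 1 = z := by
      obtain ⟨z, hz⟩ := h₃
      refine ⟨(L : ℤ) - α + z, ?_⟩
      rw [hz]
      push_cast at hα ⊢
      linarith
    rw [if_pos hc, e₁, e₂]
  · intro η hη
    rw [Function.mem_support] at hη
    have h := (ite_ne_right_iff.mp hη).2
    rw [e₁, e₂] at h
    refine Finset.mem_coe.mpr (mem_etaSet.mpr ⟨fun i => ?_, ?_, ?_⟩)
    · obtain ⟨⟨k, hk⟩, -⟩ := exists_nat_of_qbinom_ne_zero (Finset.prod_ne_zero_iff.mp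
        (right_ne_zero_of_mul (left_ne_zero_of_mul (left_ne_zero_of_mul h))) i (Finset.mem_univ i))
      have : η i = k := by exact_mod_cast hk.symm
      omega
    · obtain ⟨-, k, hk⟩ := exists_nat_of_qbinom_ne_zero
        (right_ne_zero_of_mul (left_ne_zero_of_mul h))
      exact ⟨k, by rw [hk, add_sub_cancel_left]⟩
    · obtain ⟨-, k, hk⟩ := exists_nat_of_qbinom_ne_zero (right_ne_zero_of_mul h)
      exact ⟨k, by rw [hk, add_sub_cancel_left]⟩

theorem exists_mu_eq_add {N : ℕ} (hN : 1 ≤ N) {σ δ : ℤ} {η : Fin (N - 1) → ℤ}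
    (h : ∃ z : ℤ, ((δ : ℚ) + σ * N) / (2 * N) + cinv N (toRat η) 1 = z) {i : ℕ} (hi : i ≤ N) :
    ∃ e : ℤ, ∀ A B : ℤ, A - B = δ → mu N A B η i = ((A + e : ℤ) : ℚ) := by
  have hN' : (N : ℚ) ≠ 0 := by positivity
  obtain ⟨z, hz⟩ := h
  -- The fractional parts of μ_i − A combine to −i(δ − 2∑ jη_j)/N (one-based j), and the congruence
  -- says (δ − 2∑ jη_j)/N = 2z − σ − 2∑ η_j.
  refine ⟨-i * (2 * z - σ - 2 * ∑ j, η j) -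
    2 * ∑ j : Fin (N - 1), ((min i ((j : ℕ) + 1) : ℕ) : ℤ) * η j, fun A B hAB => ?_⟩
  have e : cinv N (toRat η) i = ∑ j : Fin (N - 1), ((min i ((j : ℕ) + 1) : ℕ) : ℚ) * η j -
      i * ((∑ j : Fin (N - 1), ((j : ℕ) + 1) * (η j : ℚ)) / N) := by
    rw [cinv_eq hN _ hi, Finset.sum_div, Finset.mul_sum, ← Finset.sum_sub_distrib]
    refine Finset.sum_congr rfl fun j _ => ?_
    simp only [toRat]
    ring
  rw [cinv_one hN] at hz
  simp only [toRat] at hz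
  have hδ : ((A : ℚ) - B) = δ := by exact_mod_cast hAB
  rw [mu_eq hN A B η hi, e, hδ]
  push_cast
  rw [← hz]
  field_simp
  ring

theorem bounds_of_mem_etaSet {M L : ℕ} {m : ℤ} {η : Fin (M + 1 - 1) → ℤ} (h : η ∈ etaSet M L m) :
    0 ≤ m ∧ m ≤ ((M + 1 : ℕ) : ℤ) * L := by
  classical
  obtain ⟨n, hn, -⟩ := Finset.mem_image.mp h
  rw [tuples, Finset.mem_filter, Finset.Nat.mem_antidiagonalTuple] at hn
  obtain ⟨h₁, h₂⟩ := hn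
  rw [← h₂, ← h₁]
  refine ⟨Int.natCast_nonneg _, ?_⟩
  rw [← Nat.cast_mul, Nat.cast_le, Finset.mul_sum]
  exact Finset.sum_le_sum fun i _ => Nat.mul_le_mul_right _ (by omega)

variable [TopologicalSpace K] [IsTopologicalDivisionRing K]

theorem tendsto_etaSum {t : K} {M L : ℕ} (hq : ∀ n, poch (base (M + 1) t) n ≠ 0)
    (ht : Tendsto (fun n : ℕ => base (M + 1) t ^ n) atTop (𝓝 0)) {σ δ m : ℤ} {a : ℚ}
    (hm : (m : ℚ) = ((M + 1 : ℕ) : ℚ) * L / 2 + a)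
    {A B : ℤ → ℤ} {u v : ℤ → ℚ} (hA : Tendsto A atTop atTop) (hB : Tendsto B atTop atTop)
    (hδ : ∀ x, A x - B x = δ)
    (h₁ : ∀ x, u x - ((A x : ℚ) + B x) / 2 - ((A x : ℚ) - B x) / (2 * (M + 1 : ℕ)) =
      L - m / (M + 1 : ℕ))
    (h₂ : ∀ x, v x - ((A x : ℚ) + B x) / 2 + ((A x : ℚ) - B x) / (2 * (M + 1 : ℕ)) =
      m / (M + 1 : ℕ))
    (h₃ : ∃ z : ℤ, ((δ : ℚ) + σ * (M + 1 : ℕ)) / (2 * (M + 1 : ℕ)) = m / (M + 1 : ℕ) + z) :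
    Tendsto (fun x => poch (base (M + 1) t) L * etaSum (M + 1) t σ (A x) (B x) (u x) (v x)) atTop
      (𝓝 (multinomial (M + 1) t 0 L a)) := by
  have hδ' : ∀ x, ((A x : ℚ) - B x) = δ := fun x => by exact_mod_cast hδ x
  rw [multinomial_eq_sum t M L hm]
  simp only [fun x => etaSum_eq_sum t M L (h₁ x) (h₂ x) (by rw [hδ' x]; exact h₃),
    Finset.mul_sum]
  refine tendsto_finsetSum _ fun η hη => ?_
  obtain ⟨h₀, ⟨α, hα⟩, β, hβ⟩ := mem_etaSet.mp hη
  have hc : ∃ z : ℤ, ((δ : ℚ) + σ * (M + 1 : ℕ)) / (2 * (M + 1 : ℕ)) +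
      cinv (M + 1) (toRat η) 1 = z := by
    obtain ⟨z, hz⟩ := h₃
    refine ⟨(L : ℤ) - α + z, ?_⟩
    rw [hz]
    push_cast at hα ⊢
    linarith
  rw [← hα, ← hβ, invPoch_natCast, invPoch_natCast]
  have hprod : Tendsto (fun x => ∏ i : Fin (M + 1 - 1),
      qbinom (base (M + 1) t) (mu (M + 1) (A x) (B x) η (i + 1) + η i) (η i)) atTop
      (𝓝 (∏ i : Fin (M + 1 - 1), invPoch (base (M + 1) t) (η i : ℚ))) := by
    refine tendsto_finsetProd _ fun i _ => ?_
    obtain ⟨e, he⟩ := exists_mu_eq_add (Nat.succ_pos M) hc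
      (show (i : ℕ) + 1 ≤ M + 1 by omega)
    obtain ⟨k, hk⟩ := Int.eq_ofNat_of_zero_le (h₀ i)
    have hk' : (η i : ℚ) = k := by rw [hk]; rfl
    simp only [fun x => he (A x) (B x) (hδ x), hk', invPoch_natCast]
    exact tendsto_qbinom_right hq ht k (tendsto_atTop_add_const_right _ e hA)
  have hlim := (((hprod.mul (tendsto_qbinom_left hq ht α hA)).mul
    (tendsto_qbinom_left hq ht β hB)).const_mul
      (poch (base (M + 1) t) L * qpow (M + 1) t (quad (M + 1) (toRat η))))
  refine (hlim.congr fun x => ?_).trans_eq ?_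
  · ring
  · congr 1; ring

/-- The finite set J works for every M at once, which makes exchanging limit and sum legitimate. -/
theorem tendsto_mul_finsum_mul (x : K) (c : ℤ → K) {E : ℤ → ℤ → K} {T : ℤ → K} (J : Finset ℤ)
    (hE : ∀ j ∉ J, ∀ M, E j M = 0) (hT : ∀ j ∉ J, T j = 0)
    (h : ∀ j, Tendsto (fun M => x * E j M) atTop (𝓝 (T j))) :
    Tendsto (fun M => x * ∑ᶠ j, c j * E j M) atTop (𝓝 (∑ᶠ j, c j * T j)) := by
  have e₁ : ∀ M, ∑ᶠ j, c j * E j M = ∑ j ∈ J, c j * E j M := fun M =>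
    finsum_eq_sum_of_support_subset _ fun j hj =>
      by_contra fun h => right_ne_zero_of_mul hj (hE j h M)
  have e₂ : ∑ᶠ j, c j * T j = ∑ j ∈ J, c j * T j :=
    finsum_eq_sum_of_support_subset _ fun j hj => by_contra fun h => right_ne_zero_of_mul hj (hT j h)
  simp only [e₁, e₂, Finset.mul_sum]
  refine tendsto_finsetSum _ fun j _ => ?_
  refine ((h j).const_mul (c j)).congr fun M => ?_
  ring

end EtaSum

end QMult

end

/-! ### Part (a). -/

noncomputable section

namespace QMult

section PartOne

variable {K : Type*} [Field K]

theorem etaSet_eq_empty {M L : ℕ} {m : ℤ} (h : ¬ (0 ≤ m ∧ m ≤ ((M + 1 : ℕ) : ℤ) * L)) :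
    etaSet M L m = ∅ :=
  Finset.eq_empty_of_forall_notMem fun _ hη => h (bounds_of_mem_etaSet hη)

theorem finite_arith_bounded {P : ℤ} (hP : P ≠ 0) (m B : ℤ) :
    {j : ℤ | 0 ≤ m + P * j ∧ m + P * j ≤ B}.Finite :=
  (Set.finite_Icc 0 B).preimage (f := fun j => m + P * j) fun _ _ _ _ h =>
    mul_left_cancel₀ hP (add_left_cancel h)

theorem finite_support_mul_multinomial (t : K) (M L : ℕ) {P m : ℤ} (hP : P ≠ 0) (c : ℤ → K)
    {a : ℤ → ℚ} (hm : ∀ j, ((m + P * j : ℤ) : ℚ) = ((M + 1 : ℕ) : ℚ) * L / 2 + a j) :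
    (fun j => c j * multinomial (M + 1) t 0 L (a j)).support.Finite := by
  refine (finite_arith_bounded hP m (((M + 1 : ℕ) : ℤ) * L)).subset fun j hj => ?_
  by_contra h
  refine right_ne_zero_of_mul hj ?_
  rw [multinomial_eq_sum t M L (hm j), etaSet_eq_empty h, Finset.sum_empty]

variable [TopologicalSpace K] [IsTopologicalDivisionRing K]

/-- The limit of a sum over `j` of the `η`-sums, where the `j`-th `η`-sum depends on the summand
`m + P j` of the `q`-multinomial. -/
theorem tendsto_finsum_etaSum {t : K} {M L : ℕ} (hq : ∀ n, poch (base (M + 1) t) n ≠ 0)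
    (ht : Tendsto (fun n : ℕ => base (M + 1) t ^ n) atTop (𝓝 0)) {P σ m : ℤ} (hP : P ≠ 0)
    (c : ℤ → K) {δ : ℤ → ℤ} {a : ℤ → ℚ}
    (hm : ∀ j, ((m + P * j : ℤ) : ℚ) = ((M + 1 : ℕ) : ℚ) * L / 2 + a j)
    {A B : ℤ → ℤ → ℤ} {u v : ℤ → ℤ → ℚ} (hA : ∀ j, Tendsto (A j) atTop atTop)
    (hB : ∀ j, Tendsto (B j) atTop atTop) (hδ : ∀ j x, A j x - B j x = δ j)
    (h₁ : ∀ j x, u j x - ((A j x : ℚ) + B j x) / 2 - ((A j x : ℚ) - B j x) / (2 * (M + 1 : ℕ)) =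
      L - (m + P * j : ℤ) / (M + 1 : ℕ))
    (h₂ : ∀ j x, v j x - ((A j x : ℚ) + B j x) / 2 + ((A j x : ℚ) - B j x) / (2 * (M + 1 : ℕ)) =
      (m + P * j : ℤ) / (M + 1 : ℕ))
    (h₃ : ∀ j, ∃ z : ℤ, ((δ j : ℚ) + σ * (M + 1 : ℕ)) / (2 * (M + 1 : ℕ)) =
      (m + P * j : ℤ) / (M + 1 : ℕ) + z) :
    Tendsto (fun x => poch (base (M + 1) t) L *
        ∑ᶠ j, c j * etaSum (M + 1) t σ (A j x) (B j x) (u j x) (v j x)) atTop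
      (𝓝 (∑ᶠ j, c j * multinomial (M + 1) t 0 L (a j))) := by
  have hfin := finite_arith_bounded hP m (((M + 1 : ℕ) : ℤ) * L)
  refine tendsto_mul_finsum_mul _ c (E := fun j x => etaSum (M + 1) t σ (A j x) (B j x) (u j x)
    (v j x)) hfin.toFinset ?_ ?_ fun j => ?_
  · intro j hj x
    rw [Set.Finite.mem_toFinset] at hj
    have hδ' : ((A j x : ℚ) - B j x) = δ j := by exact_mod_cast hδ j x
    rw [etaSum_eq_sum t M L (h₁ j x) (h₂ j x) (by rw [hδ']; exact h₃ j), etaSet_eq_empty hj,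
      Finset.sum_empty]
  · intro j hj
    rw [Set.Finite.mem_toFinset] at hj
    rw [multinomial_eq_sum t M L (hm j), etaSet_eq_empty hj, Finset.sum_empty]
  · exact tendsto_etaSum hq ht (hm j) (hA j) (hB j) (hδ j) (h₁ j) (h₂ j) (h₃ j)

theorem tendsto_X {t : K} {N : ℕ} (hN : 1 ≤ N) (hq : ∀ n, poch (base N t) n ≠ 0)
    (ht : Tendsto (fun n : ℕ => base N t ^ n) atTop (𝓝 0)) {p P r s σ D m : ℤ} {L : ℕ}
    (hP : P ≠ 0) (hdvd : (N : ℤ) ∣ P - p) (hrs : (N : ℤ) ∣ r - s)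
    (hL : Even ((L : ℤ) - (r - s) / N + σ)) (hm : 2 * m = N * L + r + D - s) :
    Tendsto (fun M : ℤ => poch (base N t) L *
        X N t p P r s σ (M + D) (1 / 2 * ((L : ℚ) - D - ((r : ℚ) - s) / N))
          M (1 / 2 * ((L : ℚ) + D + ((r : ℚ) - s) / N)))
      atTop (𝓝 (bosonicSum N t p P r s D L)) := by
  obtain ⟨n, rfl⟩ := Nat.exists_eq_add_of_le' hN
  have hN' : (((n + 1 : ℕ) : ℚ)) ≠ 0 := by positivity
  obtain ⟨k, hk⟩ := hrs
  obtain ⟨l, hl⟩ := hdvd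
  rw [hk, Int.mul_ediv_cancel_left k (by positivity)] at hL
  obtain ⟨e, he⟩ := hL
  have hmQ : 2 * (m : ℚ) = ((n + 1 : ℕ) : ℚ) * L + r + D - s := by exact_mod_cast hm
  have hkQ : (r : ℚ) - s = ((n + 1 : ℕ) : ℚ) * k := by exact_mod_cast hk
  have hlQ : (P : ℚ) - p = ((n + 1 : ℕ) : ℚ) * l := by exact_mod_cast hl
  have heQ : (L : ℚ) - k + σ = e + e := by exact_mod_cast he
  have hr : (r : ℚ) = s + ((n + 1 : ℕ) : ℚ) * k := by linarith
  have hPQ : (P : ℚ) = p + ((n + 1 : ℕ) : ℚ) * l := by linarith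
  have hLQ : (L : ℚ) = k - σ + 2 * e := by linarith
  have hm₁ : ∀ j : ℤ, ((m + P * j : ℤ) : ℚ) =
      ((n + 1 : ℕ) : ℚ) * L / 2 + (1 / 2 * ((r : ℚ) + D - s) + P * j) := fun j => by
    push_cast at hmQ ⊢; linarith
  have hm₂ : ∀ j : ℤ, ((m + s + P * j : ℤ) : ℚ) =
      ((n + 1 : ℕ) : ℚ) * L / 2 + (1 / 2 * ((r : ℚ) + D + s) + P * j) := fun j => by
    push_cast at hmQ ⊢; linarith
  rw [bosonicSum, finsum_sub_distrib
    (finite_support_mul_multinomial t n L hP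
      (fun j => qpow (n + 1) t ((j : ℚ) / (n + 1 : ℕ) * (p * P * j + P * (D + r) - p * s))) hm₁)
    (finite_support_mul_multinomial t n L hP
      (fun j => qpow (n + 1) t (1 / ((n + 1 : ℕ) : ℚ) * (p * j + D + r) * (P * j + s))) hm₂)]
  simp only [X, mul_sub (poch _ _)]
  have hD : ∀ M : ℤ, ((M + D : ℤ) : ℚ) - (M : ℚ) = D := fun M => by push_cast; ring
  simp only [hD]
  have hshift : ∀ a : ℤ, Tendsto (fun M : ℤ => M + a) atTop atTop := fun a =>
    tendsto_atTop_add_const_right _ a tendsto_id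
  refine Tendsto.sub ?_ ?_
  · refine tendsto_finsum_etaSum hq ht hP _ (δ := fun j => D + 2 * p * j) hm₁ (fun j => ?_)
      (fun j => ?_) (fun j x => ?_) (fun j x => ?_) (fun j x => ?_) fun j => ?_
    · simpa only [add_assoc] using hshift (D + p * j)
    · exact hshift (-(p * j))
    · ring
    · rw [hm₁]
      push_cast at hN' hr hPQ ⊢
      rw [hPQ, hr, hLQ]
      field_simp
      ring
    · rw [hm₁]
      push_cast at hN' hr hPQ ⊢
      rw [hPQ, hr, hLQ]
      field_simp
      ring
    -- From r − s = Nk, p' − p = Nl and L − k + σ = 2e; in the second sum below, the extra 2r in δ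
    -- and s in m add (r − s)/N = k.
    · refine ⟨σ - e - k - l * j, ?_⟩
      rw [hm₁]
      push_cast at hN' hr hPQ ⊢
      rw [hPQ, hr, hLQ]
      field_simp
      ring
  · refine tendsto_finsum_etaSum hq ht hP _ (δ := fun j => D + 2 * p * j + 2 * r) hm₂ (fun j => ?_)
      (fun j => ?_) (fun j x => ?_) (fun j x => ?_) (fun j x => ?_) fun j => ?_
    · simpa only [add_assoc] using hshift (D + (p * j + r))
    · simpa only [sub_eq_add_neg, add_assoc] using hshift (-(p * j) + -r)
    · ring
    · rw [hm₂]
      push_cast at hN' hr hPQ ⊢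
      rw [hPQ, hr, hLQ]
      field_simp
      ring
    · rw [hm₂]
      push_cast at hN' hr hPQ ⊢
      rw [hPQ, hr, hLQ]
      field_simp
      ring
    · refine ⟨σ - e - l * j, ?_⟩
      rw [hm₂]
      push_cast at hN' hr hPQ ⊢
      rw [hPQ, hr, hLQ]
      field_simp
      ring

end PartOne

end QMult

end

theorem mainTheorem7 {K : Type*} [Field K] [TopologicalSpace K] [IsTopologicalDivisionRing K]
    [T2Space K] (t : K) (ht0 : t ≠ 0) (ht : Tendsto (fun n : ℕ => t ^ n) atTop (𝓝 0))
    (N : ℕ) (hN : 1 ≤ N) (p p' r s σ D : ℤ) (L : ℕ)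
    (hp : 1 ≤ p) (hpp' : p ≤ p') (hdvd : (N : ℤ) ∣ p' - p) (hrs : (N : ℤ) ∣ r - s)
    (hσ : σ = 0 ∨ σ = 1) (hD : Even (D + σ * N)) (hL : Even ((L : ℤ) - (r - s) / N + σ)) :
    Tendsto
      (fun M : ℤ => QMult.poch (QMult.base N t) L *
        QMult.X N t p p' r s σ
          (M + D) (1 / 2 * ((L : ℚ) - D - ((r : ℚ) - s) / N))
          M (1 / 2 * ((L : ℚ) + D + ((r : ℚ) - s) / N)))
      atTop (𝓝 (QMult.bosonicSum N t p p' r s D L)) ∧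
    (p' = p + N → 1 ≤ r + D → r + D ≤ p - 1 → 1 ≤ s → s ≤ p' - 1 →
      QMult.qpow N t (((s : ℚ) - (r + D)) * (s - (r + D) - N) / (4 * N)) *
          QMult.bosonicSum N t p p' r s D L =
        QMult.configSum N t p' L s (r + D) (r + D + N)) := by
  have hbase : Tendsto (fun n : ℕ => QMult.base N t ^ n) atTop (𝓝 0) := by
    simp only [QMult.base, ← pow_mul]
    exact ht.comp (tendsto_id.const_mul_atTop' (by omega : 0 < 4 * N))
  have hq : ∀ n, QMult.poch (QMult.base N t) n ≠ 0 :=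
    QMult.poch_ne_zero (QMult.pow_succ_ne_one hbase)
  obtain ⟨m, hm⟩ : ∃ m : ℤ, 2 * m = N * L + r + D - s := by
    obtain ⟨k, hk⟩ := hrs
    rw [hk, Int.mul_ediv_cancel_left k (by omega)] at hL
    obtain ⟨e, he⟩ := hL
    obtain ⟨f, hf⟩ := hD
    -- The two parity hypotheses together make NL + r + D − s even: substitute L = 2e + k − σ, D =
    -- 2f − σN and r − s = Nk.
    exact ⟨N * e + f + N * k - N * σ, by linear_combination (-(N : ℤ)) * he - hf - hk⟩
  exact ⟨QMult.tendsto_X hN hq hbase (by omega) hdvd hrs hL hm,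
    fun hP h₁ h₂ h₃ h₄ => QMult.bosonicSum_eq_configSum ht0 hN hq L hm hP h₁ h₂ h₃ h₄⟩
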